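/- All graphs and structures are finite; signatures are finite and relational. \textbf{Transductions.} A transduction is a composition of operations of three kinds: $k$-copying (a structure is replaced by the disjoint union of $k$ copies of it, together with a binary relation joining clones of the same element), coloring (adding a unary predicate, interpreted in all possible ways), and simple first-order interpretation (a domain formula with one free variable, and one formula for each relation symbol of the target signature). It maps each structure $\mathbf M$ to a set $\mathsf T(\mathbf M)$ of structures, and each element of an output is a clone of an element of $\mathbf M$. \textbf{Modelizations.} Let $\sigma$ be a signature with a unary symbol $L$; $L(\mathbf M)$ is the \emph{ground} of $\mathbf M$. A \emph{modelization} of a class $\mathscr C$ of graphs in $\sigma$-structures is a pair $(\mathsf I,\mathsf T)$, where $\mathsf I$ is an interpretation of graphs in $\sigma$-structures such that the vertex set of $\mathsf I(\mathbf M)$ is always the ground of $\mathbf M$, and $\mathsf T$ is a transduction from graphs to $\sigma$-structures such that for every $G\in\mathscr C$ there is $\mathbf M\in\mathsf T(G)$ with $\mathsf I(\mathbf M)=G$ (each vertex $v$ of $G$ being the ground element of $\mathbf M$ that is a clone of $v$). A structure $\mathbf M$ is a \emph{model} of $G$ if $\mathsf I(\mathbf M)=G$; a model $\mathbf M$ of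 $G$ is \emph{accessible} if $\mathbf M\in\mathsf T(G)$. \textbf{T-models.} A T-model with $n$ colors consists of a rooted tree, with tree-order $\preceq$, each of whose internal nodes is either unordered or ordered, the children of each ordered node being linearly ordered by a relation $\vartriangleleft$; of a coloring $\gamma$ of its leaves by $\{1,\dots,n\}$; and of a map $\kappa_u:\{1,\dots,n\}^2\to\{\bot,\top\}$ for each internal node $u$, symmetric if $u$ is unordered. It is viewed as a structure with binary relations $\preceq,\vartriangleleft$ and unary predicates for the leaves (which form the ground), for the unordered internal nodes, for the ordered internal nodes, for the colors $\gamma(x)=i$, and for the values $\kappa_x(i,j)=\top$. The interpretation $\mathsf{Build}_n$ defines the graph on the leaves in which $x$ and $y$ are adjacent if $\lambda(x,y)$ or $\lambda(y,x)$ holds, where, with $m=x\curlywedge y$ the infimum of $x$ and $y$, $\lambda(x,y)$ means that $\kappa_m(\gamma(x),\gamma(y))=\top$ and that either $m$ is unordered and $x\ne y$, or $m$ is ordered and there are $a\preceq x$, $b\preceq y$ with $a\vartriangleleft b$ (that is, $x$ is to the left of $y$). A T-model $\mathbf T$ models the graph $\mathsf{Build}_n(\mathbf T)$. The height of $\mathbf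 T$ is the maximum number of nodes on a path from the root to a leaf. For a set $X$ of leaves, $\mathbf T\langle X\rangle$ is the substructure of $\mathbf T$ induced by the set of all nodes $y$ such that $y\preceq x$ for some $x\in X$. \textbf{Bicotrees.} A \emph{bicotree} is a T-model with $2$ colors each of whose internal nodes $u$ has one of the types U ($u$ unordered, $\kappa_u(i,j)=\bot$ for all $i,j$), B ($u$ unordered, $\kappa_u(i,j)=\top$ iff $i\neq j$), O ($u$ ordered, $\kappa_u(i,j)=\top$ iff $i<j$). It is \emph{clean} if (1) for every U-node $u$, the subtrees rooted at the children of $u$ model the connected components of the graph modeled by the subtree rooted at $u$; (2) for every B-node $u$, the subtrees rooted at the children of $u$ model the bipartite complements of the connected components of the bipartite complement (with respect to the color classes) of the graph modeled by the subtree rooted at $u$; (3) for every O-node $u$, the subtree rooted at each child of $u$ contains both a leaf colored $1$ and a leaf colored $2$. A \emph{sob} is a bipartite graph with parts $V_1,V_2$ that is modeled by a bicotree with $\gamma^{-1}(1)=V_1$ and $\gamma^{-1}(2)=V_2$. \textbf{Theorem.} For every integer $h\ge 0$ there is a transduction $\mathsf{Model}_h$ such that, for every class $\mathscr C$ of sobs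 in which every graph has a clean bicotree model of height at most $h$: (a) $(\mathsf{Build}_2,\mathsf{Model}_h)$ is a modelization of $\mathscr C$; (b) for every $G\in\mathscr C$, every clean bicotree model of $G$ of height at most $h$ is accessible; (c) $(\mathbf T,X)\mapsto\mathbf T\langle X\rangle$, defined for every T-model $\mathbf T$ with $2$ colors (in particular, every bicotree) modeling a graph in $\mathscr C$ and every set $X$ of leaves of $\mathbf T$, is a model restriction: $\mathbf T\langle X\rangle$ is an induced substructure of $\mathbf T$ with $\mathsf{Build}_2(\mathbf T\langle X\rangle)=\mathsf{Build}_2(\mathbf T)[X]$. -/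

import Mathlib

open FirstOrder FirstOrder.Language FirstOrder.Language.Structure

universe u

namespace TreeModel

/-! ### Interpretations and transductions of relational structures -/

/-- A simple interpretation of `L'`-structures in `L`-structures: a domain formula with one free
variable and, for each relation symbol of arity `k`, a formula with `k` free variables. -/
structure Interpretation (L L' : FirstOrder.Language.{0, 0}) where
  dom : L.Formula (Fin 1)
  rel : ∀ {k : ℕ}, L'.Relations k → L.Formula (Fin k)

/-- The universe of the structure `I(M)`. -/
def Interpretation.Carrier {L L' : FirstOrder.Language.{0, 0}} (I : Interpretation L L') (M : Type u)
    [L.Structure M] : Type u :=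
  {x : M // I.dom.Realize ![x]}

/-- The structure `I(M)`. -/
instance Interpretation.structureCarrier {L L' : FirstOrder.Language.{0, 0}} [L'.IsRelational]
    (I : Interpretation L L') (M : Type u) [L.Structure M] : L'.Structure (I.Carrier M) where
  funMap := fun f => isEmptyElim f
  RelMap := fun r xs => (I.rel r).Realize (fun i => (xs i).1)

/-- The symbol of the clone relation introduced by a copying operation. -/
inductive CloneRel : ℕ → Type
  | clone : CloneRel 2

/-- The signature consisting of the clone relation. -/
def cloneLang : FirstOrder.Language.{0, 0} := ⟨fun _ => Empty, CloneRel⟩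

instance : cloneLang.IsRelational := fun _ => inferInstanceAs (IsEmpty Empty)

/-- The symbol of the unary predicate introduced by a coloring operation. -/
inductive MarkRel : ℕ → Type
  | mark : MarkRel 1

/-- The signature consisting of a single unary predicate. -/
def markLang : FirstOrder.Language.{0, 0} := ⟨fun _ => Empty, MarkRel⟩

instance : markLang.IsRelational := fun _ => inferInstanceAs (IsEmpty Empty)

/-- Transductions from `L`-structures to `L'`-structures: compositions of copying operations,
coloring operations and interpretations (all signatures being finite and relational). -/
inductive Transduction : FirstOrder.Language.{0, 0} → FirstOrder.Language.{0, 0} → Type 1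
  | copy {L : FirstOrder.Language.{0, 0}} [L.IsRelational] (k : ℕ) : Transduction L (L.sum cloneLang)
  | color {L : FirstOrder.Language.{0, 0}} [L.IsRelational] : Transduction L (L.sum markLang)
  | interp {L L' : FirstOrder.Language.{0, 0}} [L'.IsRelational] [Finite (Σ n, L'.Relations n)]
      (I : Interpretation L L') : Transduction L L'
  /-- `comp S T` is `T ∘ S`: first apply `S`, then `T`. -/
  | comp {L L' L'' : FirstOrder.Language.{0, 0}} (S : Transduction L L') (T : Transduction L' L'') :
      Transduction L L''

/-- `T.Outputs M N o` says that the structure `N` belongs to `T(M)`, up to the names of its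
elements, and that `o` is the map which sends every element of `N` to the element of `M` of which
it is a clone.
* Copying: `N` is the disjoint union of `k` copies of `M`, with the relation that joins
  two elements if they are clones of the same element of `M`.
* Coloring: `N` is `M` with one more unary predicate, interpreted in an arbitrary way.
* Interpreting: `N` is `I(M)`.
* Composition: `(T ∘ S)(M)` is the union of the sets `T(P)` with `P ∈ S(M)`. -/
def Transduction.Outputs : ∀ {L L' : FirstOrder.Language.{0, 0}}, Transduction L L' →
    ∀ (M : Type u) [L.Structure M] (N : Type u) [L'.Structure N], (N → M) → Prop
  | _, _, @Transduction.copy L _ k, M, _, N, _, o =>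
      ∃ e : N ≃ M × Fin k,
        (∀ x, o x = (e x).1) ∧
        (∀ (n : ℕ) (r : L.Relations n) (xs : Fin n → N),
          RelMap (L := L.sum cloneLang) (Sum.inl r : (L.sum cloneLang).Relations n) xs ↔
            ∃ i : Fin k, (∀ j, (e (xs j)).2 = i) ∧ RelMap r (fun j => (e (xs j)).1)) ∧
        (∀ x y : N,
          RelMap (L := L.sum cloneLang)
              (Sum.inr CloneRel.clone : (L.sum cloneLang).Relations 2) ![x, y] ↔
            (e x).1 = (e y).1)
  | _, _, @Transduction.color L _, M, _, N, _, o =>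
      ∃ e : N ≃ M,
        (∀ x, o x = e x) ∧
        (∀ (n : ℕ) (r : L.Relations n) (xs : Fin n → N),
          RelMap (L := L.sum markLang) (Sum.inl r : (L.sum markLang).Relations n) xs ↔
            RelMap r (fun j => e (xs j)))
  | _, _, @Transduction.interp L L' _ _ I, M, _, N, _, o =>
      ∃ e : N ≃[L'] I.Carrier M, ∀ x, o x = (e x).1
  | _, _, @Transduction.comp L L' L'' S T, M, _, N, _, o =>
      ∃ (P : Type u) (_ : L'.Structure P) (o₁ : P → M) (o₂ : N → P),
        S.Outputs M P o₁ ∧ T.Outputs P N o₂ ∧ o = o₁ ∘ o₂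

/-! ### Modelizations -/

/-- A class of graphs. -/
abbrev GraphClass : Type (u + 1) := ∀ V : Type u, SimpleGraph V → Prop

/-- The equality `I(M) = G`, where the vertex set of `I(M)` is identified with that of `G`
through `ι`. -/
def Interpretation.Models {L : FirstOrder.Language.{0, 0}} (I : Interpretation L FirstOrder.Language.graph)
    (M : Type u) [L.Structure M] {V : Type u} (G : SimpleGraph V) (ι : I.Carrier M ≃ V) : Prop :=
  ∀ x y : I.Carrier M, RelMap adj ![x, y] ↔ G.Adj (ι x) (ι y)

/-- The structure `M`, whose ground is identified with `V(G)` through `ι`, belongs to `T(G)`: it is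
an output of `T` on `G` in which each ground element is a clone of the vertex that it is. -/
def IsAccessible {L : FirstOrder.Language.{0, 0}} (I : Interpretation L FirstOrder.Language.graph)
    (T : Transduction FirstOrder.Language.graph L) (M : Type u) [L.Structure M] {V : Type u}
    (G : SimpleGraph V) (ι : I.Carrier M ≃ V) : Prop :=
  letI := G.structure
  ∃ o : M → V, T.Outputs V M o ∧ ∀ x : I.Carrier M, o x.1 = ι x

/-- `(I, T)` is a modelization of the class `C` in `L`-structures, where `ground` is the symbol of
`L` for the ground. -/
def IsModelization {L : FirstOrder.Language.{0, 0}} (ground : L.Relations 1) (C : GraphClass.{u})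
    (I : Interpretation L FirstOrder.Language.graph) (T : Transduction FirstOrder.Language.graph L) : Prop :=
  (∀ (M : Type u) [L.Structure M] (x : M), I.dom.Realize ![x] ↔ RelMap ground ![x]) ∧
  ∀ (V : Type u) (G : SimpleGraph V), C V G →
    ∃ (M : Type u) (_ : L.Structure M) (ι : I.Carrier M ≃ V),
      I.Models M G ι ∧ IsAccessible I T M G ι

/-- In a relational signature, every subset induces a substructure. -/
def inducedSub {L : FirstOrder.Language.{0, 0}} [L.IsRelational] {M : Type u} [L.Structure M] (S : Set M) :
    L.Substructure M :=
  ⟨S, fun f => isEmptyElim f⟩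

/-- The mapping `restr`, which sends a model `M` in the class `D` of a graph in `C` and a subset
`X` of the ground of `M` to an induced substructure of `M`, is a model restriction:
`I(restr(M, X)) = I(M)[X]`. -/
def IsModelRestriction {L : FirstOrder.Language.{0, 0}} (C : GraphClass.{u})
    (I : Interpretation L FirstOrder.Language.graph)
    (D : ∀ (M : Type u) [L.Structure M], Prop)
    (restr : ∀ (M : Type u) [L.Structure M], Set M → L.Substructure M) : Prop :=
  ∀ (V : Type u) (G : SimpleGraph V), C V G →
    ∀ (M : Type u) [L.Structure M], D M → ∀ ι : I.Carrier M ≃ V, I.Models M G ι →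
      ∀ X : Set M, (∀ x ∈ X, I.dom.Realize ![x]) →
        X ⊆ (restr M X : Set M) ∧
        (∀ y : restr M X, I.dom.Realize ![y] ↔ (y : M) ∈ X) ∧
        ∀ y z : restr M X, (y : M) ∈ X → (z : M) ∈ X →
          ((I.rel adj).Realize ![y, z] ↔ (I.rel adj).Realize ![(y : M), (z : M)])

/-! ### T-models -/

/-- The relation symbols of T-models with `n` colors: the tree-order `≼` and the order `◁` on the
children of ordered nodes; the predicates for leaves (the ground), for the internal nodes whose
children are unordered (`A`) and for those whose children are ordered (`C`); the color predicates
`γ(x) = i` and the predicates `κ_x(i, j) = ⊤`. -/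
inductive TRel (n : ℕ) : ℕ → Type
  | le : TRel n 2
  | lt : TRel n 2
  | leaf : TRel n 1
  | unordered : TRel n 1
  | ordered : TRel n 1
  | gamma (i : Fin n) : TRel n 1
  | kappa (i j : Fin n) : TRel n 1

/-- The signature of T-models with `n` colors. -/
def tLang (n : ℕ) : FirstOrder.Language.{0, 0} := ⟨fun _ => Empty, TRel n⟩

instance (n : ℕ) : (tLang n).IsRelational := fun _ => inferInstanceAs (IsEmpty Empty)

instance (n : ℕ) : Finite (Σ k, (tLang n).Relations k) := by
  let f : (Unit ⊕ Unit ⊕ Unit ⊕ Unit ⊕ Unit ⊕ Fin n ⊕ (Fin n × Fin n)) →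
      Σ k, (tLang n).Relations k := fun s => match s with
    | .inl _ => ⟨2, TRel.le⟩
    | .inr (.inl _) => ⟨2, TRel.lt⟩
    | .inr (.inr (.inl _)) => ⟨1, TRel.leaf⟩
    | .inr (.inr (.inr (.inl _))) => ⟨1, TRel.unordered⟩
    | .inr (.inr (.inr (.inr (.inl _)))) => ⟨1, TRel.ordered⟩
    | .inr (.inr (.inr (.inr (.inr (.inl i))))) => ⟨1, TRel.gamma i⟩
    | .inr (.inr (.inr (.inr (.inr (.inr p))))) => ⟨1, TRel.kappa p.1 p.2⟩
  refine Finite.of_surjective f ?_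
  rintro ⟨k, r⟩
  cases r with
  | le => exact ⟨.inl (), rfl⟩
  | lt => exact ⟨.inr (.inl ()), rfl⟩
  | leaf => exact ⟨.inr (.inr (.inl ())), rfl⟩
  | unordered => exact ⟨.inr (.inr (.inr (.inl ()))), rfl⟩
  | ordered => exact ⟨.inr (.inr (.inr (.inr (.inl ())))), rfl⟩
  | gamma i => exact ⟨.inr (.inr (.inr (.inr (.inr (.inl i))))), rfl⟩
  | kappa i j => exact ⟨.inr (.inr (.inr (.inr (.inr (.inr (i, j)))))), rfl⟩

/-- The symbol `≼`. -/
def leSym (n : ℕ) : (tLang n).Relations 2 := TRel.le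
/-- The symbol `◁`. -/
def ltSym (n : ℕ) : (tLang n).Relations 2 := TRel.lt
/-- The symbol `L` of the ground. -/
def leafSym (n : ℕ) : (tLang n).Relations 1 := TRel.leaf
/-- The symbol `A`. -/
def unorderedSym (n : ℕ) : (tLang n).Relations 1 := TRel.unordered
/-- The symbol `C`. -/
def orderedSym (n : ℕ) : (tLang n).Relations 1 := TRel.ordered
/-- The symbol of the predicate `γ(x) = i`. -/
def gammaSym {n : ℕ} (i : Fin n) : (tLang n).Relations 1 := TRel.gamma i
/-- The symbol of the predicate `κ_x(i, j) = ⊤`. -/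
def kappaSym {n : ℕ} (i j : Fin n) : (tLang n).Relations 1 := TRel.kappa i j

section Semantics

variable (n : ℕ) {M : Type u} [(tLang n).Structure M]

/-- `x ≼ y` -/
def Le (x y : M) : Prop := RelMap (leSym n) ![x, y]
/-- `x ◁ y` -/
def Lt (x y : M) : Prop := RelMap (ltSym n) ![x, y]
/-- `x` is marked as a leaf. -/
def Leaf (x : M) : Prop := RelMap (leafSym n) ![x]
/-- `x` is marked as an internal node with unordered children. -/
def Unordered (x : M) : Prop := RelMap (unorderedSym n) ![x]
/-- `x` is marked as an internal node with ordered children. -/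
def Ordered (x : M) : Prop := RelMap (orderedSym n) ![x]
/-- `γ(x) = i` -/
def Gamma {n : ℕ} {M : Type u} [(tLang n).Structure M] (i : Fin n) (x : M) : Prop :=
  RelMap (gammaSym i) ![x]
/-- `κ_x(i, j) = ⊤` -/
def Kappa {n : ℕ} {M : Type u} [(tLang n).Structure M] (i j : Fin n) (x : M) : Prop :=
  RelMap (kappaSym i j) ![x]

/-- `y` is a child of `x`: it covers `x` in the tree-order. -/
def Child (x y : M) : Prop :=
  Le n x y ∧ x ≠ y ∧ ∀ z : M, Le n x z → Le n z y → z = x ∨ z = y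

end Semantics

/-- The structure `M` is a T-model with `n` colors. -/
structure IsTModel (n : ℕ) (M : Type u) [(tLang n).Structure M] : Prop where
  finite : Finite M
  -- `≼` is a tree-order
  le_refl : ∀ x : M, Le n x x
  le_antisymm : ∀ x y : M, Le n x y → Le n y x → x = y
  le_trans : ∀ x y z : M, Le n x y → Le n y z → Le n x z
  root : ∃ r : M, ∀ x : M, Le n r x
  chain : ∀ x y z : M, Le n x z → Le n y z → Le n x y ∨ Le n y x
  -- the node set is partitioned into leaves, unordered internal nodes, ordered internal nodes
  leaf_iff : ∀ x : M, Leaf n x ↔ ∀ y : M, Le n x y → y = x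
  internal : ∀ x : M, ¬ Leaf n x ↔ Unordered n x ∨ Ordered n x
  unordered_not_ordered : ∀ x : M, Unordered n x → ¬ Ordered n x
  -- `◁` is a strict partial order, which compares exactly the pairs of children of ordered nodes
  lt_irrefl : ∀ x : M, ¬ Lt n x x
  lt_trans : ∀ x y z : M, Lt n x y → Lt n y z → Lt n x z
  lt_total : ∀ x y : M, (Lt n x y ∨ Lt n y x) ↔
    x ≠ y ∧ ∃ m : M, Ordered n m ∧ Child n m x ∧ Child n m y
  -- `γ` is a coloring of the leaves
  gamma_leaf : ∀ x : M, Leaf n x → ∃! i : Fin n, Gamma i x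
  gamma_internal : ∀ x : M, ¬ Leaf n x → ∀ i : Fin n, ¬ Gamma i x
  -- `κ` is defined on the internal nodes, with symmetric values on the unordered ones
  kappa_leaf : ∀ x : M, Leaf n x → ∀ i j : Fin n, ¬ Kappa i j x
  kappa_symm : ∀ x : M, Unordered n x → ∀ i j : Fin n, Kappa i j x → Kappa j i x

/-- The height is at most `h`: there are at most `h` nodes on the path from the root to any
leaf. -/
def HeightLE (n : ℕ) (M : Type u) [(tLang n).Structure M] (h : ℕ) : Prop :=
  ∀ x : M, Leaf n x → {y : M | Le n y x}.ncard ≤ h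

/-- `T⟨X⟩`: the substructure induced by the downset generated by `X`. -/
def restrictTo (n : ℕ) (M : Type u) [(tLang n).Structure M] (X : Set M) :
    (tLang n).Substructure M :=
  inducedSub {y | ∃ x ∈ X, Le n y x}

/-! ### The interpretation `Build` -/

section Formulas

variable (n : ℕ) {k : ℕ}

/-- Atomic formula `s ≼ t`. -/
def leF (s t : (tLang n).Term (Fin 2 ⊕ Fin k)) : (tLang n).BoundedFormula (Fin 2) k :=
  (leSym n).boundedFormula₂ s t

/-- Free variable number `i`. -/
def fv (i : Fin 2) : (tLang n).Term (Fin 2 ⊕ Fin k) := Term.var (Sum.inl i)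

/-- Bound variable number `i`. -/
def bv (i : Fin k) : (tLang n).Term (Fin 2 ⊕ Fin k) := Term.var (Sum.inr i)

/-- The formula `m = x ⋏ y`, where `m` is the bound variable number `0`. -/
def meetF (x y : Fin 2) : (tLang n).BoundedFormula (Fin 2) 1 :=
  leF n (bv n 0) (fv n x) ⊓ leF n (bv n 0) (fv n y) ⊓
    ∀' ((leF n (bv n 1) (fv n x) ⊓ leF n (bv n 1) (fv n y)) ⟹ leF n (bv n 1) (bv n 0))

/-- The formula `x < y`: some ancestors `a ≼ x` and `b ≼ y` satisfy `a ◁ b`. -/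
def ltF (x y : Fin 2) : (tLang n).BoundedFormula (Fin 2) 1 :=
  ∃' ∃' (leF n (bv n 1) (fv n x) ⊓ leF n (bv n 2) (fv n y) ⊓
    (ltSym n).boundedFormula₂ (bv n 1) (bv n 2))

/-- The formula `κ_m(γ(x), γ(y)) = ⊤`, where `m` is the bound variable number `0`. -/
noncomputable def kappaF (x y : Fin 2) : (tLang n).BoundedFormula (Fin 2) 1 :=
  BoundedFormula.iSup fun p : Fin n × Fin n =>
    (gammaSym p.1).boundedFormula₁ (fv n x) ⊓ (gammaSym p.2).boundedFormula₁ (fv n y) ⊓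
      (kappaSym p.1 p.2).boundedFormula₁ (bv n 0)

/-- The formula `λ(x, y)`: for `m = x ⋏ y`, either `m` is unordered and `x ≠ y`, or `m` is ordered
and `x < y`; and `κ_m(γ(x), γ(y)) = ⊤`. -/
noncomputable def lambdaF (x y : Fin 2) : (tLang n).Formula (Fin 2) :=
  ∃' (meetF n x y ⊓
    (((unorderedSym n).boundedFormula₁ (bv n 0) ⊓ ∼((fv n x) =' (fv n y))) ⊔
      ((orderedSym n).boundedFormula₁ (bv n 0) ⊓ ltF n x y)) ⊓
    kappaF n x y)

end Formulas

/-- The interpretation `Build_n` of graphs in T-models with `n` colors: the vertices are the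
leaves and `x`, `y` are adjacent if `λ(x, y)` or `λ(y, x)`. -/
noncomputable def build (n : ℕ) : Interpretation (tLang n) FirstOrder.Language.graph where
  dom := (leafSym n).formula₁ (Term.var 0)
  rel := fun r => match r with
    | graphRel.adj => lambdaF n 0 1 ⊔ lambdaF n 1 0

/-- The relation defined by the formula `λ`. -/
def Lambda (n : ℕ) {M : Type u} [(tLang n).Structure M] (x y : M) : Prop :=
  ∃ m : M, (Le n m x ∧ Le n m y ∧ ∀ z : M, Le n z x → Le n z y → Le n z m) ∧
    ((Unordered n m ∧ x ≠ y) ∨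
      (Ordered n m ∧ ∃ a b : M, Le n a x ∧ Le n b y ∧ Lt n a b)) ∧
    ∃ i j : Fin n, Gamma i x ∧ Gamma j y ∧ Kappa i j m

theorem build_dom_realize (n : ℕ) {M : Type u} [(tLang n).Structure M] (x : M) :
    (build n).dom.Realize ![x] ↔ Leaf n x := by
  simp [build, Leaf]

theorem build_adj_realize (n : ℕ) {M : Type u} [(tLang n).Structure M] (x y : M) :
    ((build n).rel adj).Realize ![x, y] ↔ Lambda n x y ∨ Lambda n y x := by
  simp [build, lambdaF, Lambda, meetF, ltF, kappaF, leF, fv, bv, Formula.Realize, Fin.snoc,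
    Le, Lt, Ordered, Unordered, Gamma, Kappa, BoundedFormula.realize_rel₁,
    BoundedFormula.realize_rel₂]
  simp only [and_assoc, exists_and_left]

/-! ### Bicotrees -/

section Bicotrees

variable {M : Type u} [(tLang 2).Structure M]

/-- Nodes of type U (union): unordered, with `κ_u(i, j) = ⊥`. -/
def IsU (u : M) : Prop := Unordered 2 u ∧ ∀ i j : Fin 2, ¬ Kappa i j u
/-- Nodes of type B (bijoin): unordered, with `κ_u(i, j) = (i ≠ j)`. -/
def IsB (u : M) : Prop := Unordered 2 u ∧ ∀ i j : Fin 2, Kappa i j u ↔ i ≠ j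
/-- Nodes of type O (ordered bijoin): ordered, with `κ_u(i, j) = (i < j)`. -/
def IsO (u : M) : Prop := Ordered 2 u ∧ ∀ i j : Fin 2, Kappa i j u ↔ i < j

variable (M) in
/-- Bicotrees: T-models with two colors whose internal nodes have type U, B or O. -/
structure IsBicotree : Prop extends IsTModel 2 M where
  types : ∀ u : M, ¬ Leaf 2 u → IsU u ∨ IsB u ∨ IsO u

/-- The graph modeled by the subtree rooted at `u`, on the set of leaves below `u` (the
adjacency `Build_2` of a T-model is symmetric and irreflexive, so that `fromRel` is harmless). -/
def subtreeGraph (u : M) : SimpleGraph {x : M // Leaf 2 x ∧ Le 2 u x} :=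
  SimpleGraph.fromRel fun x y => ((build 2).rel adj).Realize ![x.1, y.1]

/-- The bipartite complement of the graph modeled by the subtree rooted at `u`, with respect to
the two color classes. -/
def subtreeBipCompl (u : M) : SimpleGraph {x : M // Leaf 2 x ∧ Le 2 u x} :=
  SimpleGraph.fromRel fun x y =>
    (Gamma (n := 2) 0 x.1 ∧ Gamma (n := 2) 1 y.1) ∧ ¬ (subtreeGraph u).Adj x y

variable (M) in
/-- Clean bicotrees. The subtree rooted at a child `v` of `u` models an induced subgraph of the
graph of `u`, so the conditions at U-nodes and B-nodes are that the sets of leaves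
of the subtrees of the children of `u` are the (vertex sets of the) connected components of the
graph modeled by the subtree of `u`, respectively of its bipartite complement. -/
structure IsCleanBicotree : Prop extends IsBicotree M where
  clean_U : ∀ u : M, IsU u → ∀ x y : {x : M // Leaf 2 x ∧ Le 2 u x},
    (subtreeGraph u).Reachable x y ↔ ∃ v : M, Child 2 u v ∧ Le 2 v x.1 ∧ Le 2 v y.1
  clean_B : ∀ u : M, IsB u → ∀ x y : {x : M // Leaf 2 x ∧ Le 2 u x},
    (subtreeBipCompl u).Reachable x y ↔ ∃ v : M, Child 2 u v ∧ Le 2 v x.1 ∧ Le 2 v y.1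
  clean_O : ∀ u : M, IsO u → ∀ v : M, Child 2 u v → ∀ i : Fin 2,
    ∃ x : M, Leaf 2 x ∧ Le 2 v x ∧ Gamma i x

end Bicotrees

/-- `G` is a sob: a bipartite graph with parts `V₀` and `V₁` having, as a T-model, a bicotree in
which `V₀` and `V₁` are the color classes. -/
def IsSob {V : Type u} (G : SimpleGraph V) : Prop :=
  ∃ P : Fin 2 → Set V, G.IsBipartiteWith (P 0) (P 1) ∧ P 0 ∪ P 1 = Set.univ ∧
    ∃ (M : Type u) (_ : (tLang 2).Structure M) (ι : (build 2).Carrier M ≃ V),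
      IsBicotree M ∧ (build 2).Models M G ι ∧
      ∀ (i : Fin 2) (x : (build 2).Carrier M), Gamma i x.1 ↔ ι x ∈ P i

end TreeModel

open TreeModel

/-! Let `M` be a clean bicotree of height at most `h` modeling `G`. Choose for each node `u` a leaf
`rep u` with `u ≼ rep u`, and send `u` to the clone of `rep u` in the copy indexed by the level of
`u`. This is injective, since a leaf has only one ancestor on each level. Thus the tree lives on
boundedly many copies of `G`, and finitely many unary predicates can record, for each vertex and
each level, the type, the colors, the `κ` values and so on of the ancestor at that level. Coloring
operations supply these predicates; it remains to define `≼` and `◁` by first-order formulas that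
depend on `h` only.

Both reduce to the relation "same ancestor at level `d`", defined by induction on `d`
(`encode_sameNode_iff`). Below a U-node, cleanness says that two leaves lie under the same child
exactly when they are connected in the graph of that subtree; below a B-node, the same holds in the
bipartite complement. Connectivity is first-order here because neither graph has an induced path on
seven vertices (`not_isSevenPath_bAdj`, `not_isSevenPath_coAdj`), so five steps suffice to join
connected vertices (`linked_five_of_linked`).

Below an O-node, adjacency between leaves of different colors under different children tells which
child is on the left. Marking the positions of the children modulo 3 certifies that two children
differ, and chains of at most three such comparisons detect the order of children with the same
residue (`encode_before_of_pos`); cleanness provides leaves of both colors for these chains.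

The resulting transduction outputs every clean model of height at most `h`, which gives (b), and (a)
follows. Part (c) is independent: `T⟨X⟩` is closed under ancestors, so it contains the infima and
the witnesses on which adjacency depends. -/

namespace TreeModel

/-! ### Uniform definability in copies of marked graphs -/

/-- A graph whose vertices carry marks, indexed by a level and a tag. -/
structure MarkedGraph (Tag : Type) : Type (u + 1) where
  V : Type u
  G : SimpleGraph V
  mark : ℕ → Tag → V → Prop

/-- The vertex set of the disjoint union of `k` copies of a marked graph. -/
abbrev MarkedGraph.Copies {Tag : Type} (k : ℕ) (D : MarkedGraph.{u} Tag) : Type u := D.V × Fin k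

/-- The signature of graphs with clones and `n` unary predicates. -/
def colorLang : ℕ → FirstOrder.Language.{0, 0}
  | 0 => FirstOrder.Language.graph.sum cloneLang
  | n + 1 => (colorLang n).sum markLang

instance colorLang_isRelational : ∀ n, (colorLang n).IsRelational
  | 0 => inferInstanceAs (FirstOrder.Language.graph.sum cloneLang).IsRelational
  | n + 1 =>
    have := colorLang_isRelational n
    inferInstanceAs ((colorLang n).sum markLang).IsRelational

/-- Copying followed by `n` coloring operations. -/
def colorTransduction (k : ℕ) : ∀ n, Transduction FirstOrder.Language.graph (colorLang n)
  | 0 => Transduction.copy k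
  | n + 1 => Transduction.comp (colorTransduction k n) Transduction.color

section Copies

variable {Tag : Type} {k : ℕ}

/-- The disjoint union of `k` copies of a graph. -/
instance copiesGraphStructure (D : MarkedGraph.{u} Tag) :
    FirstOrder.Language.graph.Structure (D.Copies k) where
  funMap := fun f => isEmptyElim f
  RelMap := fun r xs => ∃ i : Fin k, (∀ j, (xs j).2 = i) ∧
    @RelMap _ _ D.G.structure _ r (fun j => (xs j).1)

/-- The clone relation. -/
instance copiesCloneStructure (D : MarkedGraph.{u} Tag) : cloneLang.Structure (D.Copies k) where
  funMap := fun f => isEmptyElim f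
  RelMap := fun r => match r with
    | CloneRel.clone => fun xs => (xs 0).1 = (xs 1).1

/-- The unary predicate number `n` on the copies: either the index of the copy is fixed, or the
mark of the original vertex. -/
def copiesColor [Finite Tag] (D : MarkedGraph.{u} Tag) (n : ℕ) (w : D.Copies k) : Prop :=
  ∃ p : Fin k × Option Tag, (Finite.equivFin (Fin k × Option Tag) p : ℕ) = n ∧
    match p.2 with
    | none => w.2 = p.1
    | some t => D.mark p.1 t w.1

/-- A single unary predicate. -/
abbrev copiesMarkStructure [Finite Tag] (D : MarkedGraph.{u} Tag) (n : ℕ) :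
    markLang.Structure (D.Copies k) where
  funMap := fun f => isEmptyElim f
  RelMap := fun r => match r with
    | MarkRel.mark => fun xs => copiesColor D n (xs 0)

instance copiesStructure [Finite Tag] (D : MarkedGraph.{u} Tag) :
    ∀ n, (colorLang n).Structure (D.Copies k)
  | 0 => inferInstanceAs ((FirstOrder.Language.graph.sum cloneLang).Structure (D.Copies k))
  | n + 1 =>
    letI := copiesStructure D n
    letI := copiesMarkStructure (k := k) D n
    inferInstanceAs (((colorLang n).sum markLang).Structure (D.Copies k))

/-- A coloring operation leaves the new predicate arbitrary, so any prescribed family of marks is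
among its results. -/
theorem colorTransduction_outputs [Finite Tag] (D : MarkedGraph.{u} Tag) (n : ℕ) :
    letI := D.G.structure
    (colorTransduction k n).Outputs D.V (D.Copies k) Prod.fst := by
  induction n with
  | zero =>
    refine ⟨Equiv.refl _, fun _ => rfl, fun n r xs => Iff.rfl, fun x y => Iff.rfl⟩
  | succ n ih =>
    refine ⟨D.Copies k, copiesStructure D n, Prod.fst, id, ih, ?_, rfl⟩
    exact ⟨Equiv.refl _, fun _ => rfl, fun n r xs => Iff.rfl⟩

theorem exists_adj_symbol [Finite Tag] (n : ℕ) : ∃ r : (colorLang n).Relations 2,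
    ∀ (D : MarkedGraph.{u} Tag) (a b : D.Copies k),
      RelMap r ![a, b] ↔ a.2 = b.2 ∧ D.G.Adj a.1 b.1 := by
  induction n with
  | zero =>
    refine ⟨(Sum.inl adj : (FirstOrder.Language.graph.sum cloneLang).Relations 2), fun D a b => ?_⟩
    change (∃ i : Fin k, (∀ j, ((![a, b] : Fin 2 → D.Copies k) j).2 = i) ∧ D.G.Adj a.1 b.1) ↔ _
    simp [Fin.forall_fin_two]
    grind
  | succ n ih =>
    obtain ⟨r, hr⟩ := ih
    exact ⟨(Sum.inl r : ((colorLang n).sum markLang).Relations 2), fun D a b => hr D a b⟩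

theorem exists_clone_symbol [Finite Tag] (n : ℕ) : ∃ r : (colorLang n).Relations 2,
    ∀ (D : MarkedGraph.{u} Tag) (a b : D.Copies k), RelMap r ![a, b] ↔ a.1 = b.1 := by
  induction n with
  | zero =>
    exact ⟨(Sum.inr CloneRel.clone : (FirstOrder.Language.graph.sum cloneLang).Relations 2),
      fun D a b => Iff.rfl⟩
  | succ n ih =>
    obtain ⟨r, hr⟩ := ih
    exact ⟨(Sum.inl r : ((colorLang n).sum markLang).Relations 2), fun D a b => hr D a b⟩

theorem exists_color_symbol [Finite Tag] {m n : ℕ} (h : m < n) :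
    ∃ r : (colorLang n).Relations 1,
      ∀ (D : MarkedGraph.{u} Tag) (a : D.Copies k), RelMap r ![a] ↔ copiesColor D m a := by
  induction n with
  | zero => exact absurd h (Nat.not_lt_zero m)
  | succ n ih =>
    rcases Nat.lt_succ_iff_lt_or_eq.1 h with h | rfl
    · obtain ⟨r, hr⟩ := ih h
      exact ⟨(Sum.inl r : ((colorLang n).sum markLang).Relations 1), fun D a => hr D a⟩
    · exact ⟨(Sum.inr MarkRel.mark : ((colorLang m).sum markLang).Relations 1),
        fun D a => Iff.rfl⟩

end Copies

/-- The signature of `k` copies of graphs with marks on `k` levels. -/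
noncomputable abbrev copiesLang (Tag : Type) (k : ℕ) : FirstOrder.Language.{0, 0} :=
  colorLang (Nat.card (Fin k × Option Tag))

/-- The relation `Φ` on `k` copies of marked graphs is defined by one first-order formula. -/
def UDef {Tag : Type} [Finite Tag] {k : ℕ} {α : Type}
    (Φ : ∀ D : MarkedGraph.{u} Tag, (α → D.Copies k) → Prop) : Prop :=
  ∃ φ : (copiesLang Tag k).Formula α, ∀ (D : MarkedGraph.{u} Tag) (v : α → D.Copies k),
    φ.Realize v ↔ Φ D v

/-! ### Closure properties of uniform definability. -/

namespace UDef

variable {Tag : Type} [Finite Tag] {k : ℕ} {α : Type}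
  {Φ Ψ : ∀ D : MarkedGraph.{u} Tag, (α → D.Copies k) → Prop}

theorem true : UDef.{u} (Tag := Tag) (k := k) (α := α) fun _ _ => True :=
  ⟨⊤, fun _ _ => by simp [Formula.Realize]⟩

theorem not (h : UDef Φ) : UDef fun D v => ¬ Φ D v := by
  obtain ⟨φ, hφ⟩ := h
  exact ⟨∼φ, fun D v => by rw [Formula.realize_not, hφ]⟩

theorem and (h : UDef Φ) (h' : UDef Ψ) : UDef fun D v => Φ D v ∧ Ψ D v := by
  obtain ⟨φ, hφ⟩ := h
  obtain ⟨ψ, hψ⟩ := h'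
  exact ⟨φ ⊓ ψ, fun D v => by rw [Formula.realize_inf, hφ, hψ]⟩

theorem or (h : UDef Φ) (h' : UDef Ψ) : UDef fun D v => Φ D v ∨ Ψ D v := by
  obtain ⟨φ, hφ⟩ := h
  obtain ⟨ψ, hψ⟩ := h'
  exact ⟨φ ⊔ ψ, fun D v => by rw [Formula.realize_sup, hφ, hψ]⟩

theorem exists_finite {β : Type} [Finite β]
    {Θ : β → ∀ D : MarkedGraph.{u} Tag, (α → D.Copies k) → Prop} (h : ∀ b, UDef (Θ b)) :
    UDef fun D v => ∃ b, Θ b D v := by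
  choose φ hφ using h
  refine ⟨BoundedFormula.iSup φ, fun D v => ?_⟩
  rw [Formula.Realize, BoundedFormula.realize_iSup]
  exact exists_congr fun b => hφ b D v

/-- Quantification over the vertices of the marked graph. -/
theorem ex [NeZero k] {P : ∀ D : MarkedGraph.{u} Tag, (α → D.Copies k) → D.V → Prop}
    (h : UDef (α := Option α) fun D v => P D (fun a => v (some a)) (v none).1) :
    UDef fun D v => ∃ x, P D v x := by
  obtain ⟨φ, hφ⟩ := h
  let g : Option α → α ⊕ Unit := fun o => o.elim (Sum.inr ()) Sum.inl
  refine ⟨(φ.relabel g).iExs Unit, fun D v => ?_⟩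
  rw [Formula.realize_iExs]
  constructor
  · rintro ⟨i, hi⟩
    rw [Formula.realize_relabel, hφ] at hi
    exact ⟨_, hi⟩
  · rintro ⟨x, hx⟩
    -- Any clone of `x` would do; copy `0` exists because `k ≠ 0`.
    refine ⟨fun _ => (x, 0), ?_⟩
    rw [Formula.realize_relabel, hφ]
    exact hx

theorem eq (i j : α) : UDef.{u} (Tag := Tag) (k := k) fun _ v => (v i).1 = (v j).1 := by
  obtain ⟨r, hr⟩ := exists_clone_symbol.{u} (Tag := Tag) (k := k) (Nat.card (Fin k × Option Tag))
  exact ⟨r.formula₂ (Term.var i) (Term.var j), fun D v => by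
    rw [Formula.realize_rel₂]; exact hr D _ _⟩

theorem color (i : α) (p : Fin k × Option Tag) : UDef.{u} (Tag := Tag) (k := k) fun D v =>
    match p.2 with
    | none => (v i).2 = p.1
    | some t => D.mark p.1 t (v i).1 := by
  obtain ⟨r, hr⟩ := exists_color_symbol.{u} (Tag := Tag) (k := k)
    (Finite.equivFin (Fin k × Option Tag) p).isLt
  refine ⟨r.formula₁ (Term.var i), fun D v => ?_⟩
  rw [Formula.realize_rel₁]
  refine (hr D _).trans ⟨?_, fun h => ⟨p, rfl, h⟩⟩
  rintro ⟨q, hq, h⟩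
  obtain rfl := (Finite.equivFin (Fin k × Option Tag)).injective (Fin.ext hq)
  exact h

theorem copy (i : α) (c : Fin k) : UDef.{u} (Tag := Tag) (k := k) fun _ v => (v i).2 = c :=
  color i (c, none)

theorem mark (i : α) {d : ℕ} (hd : d < k) (t : Tag) :
    UDef.{u} (Tag := Tag) (k := k) fun D v => D.mark d t (v i).1 :=
  color i (⟨d, hd⟩, some t)

/-- The edge relation of the copies only joins vertices of the same copy. The formula therefore
replaces the second vertex by a clone of it that is adjacent to the first. -/
theorem adj (i j : α) : UDef.{u} (Tag := Tag) (k := k) fun D v => D.G.Adj (v i).1 (v j).1 := by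
  obtain ⟨r, hr⟩ := exists_adj_symbol.{u} (Tag := Tag) (k := k) (Nat.card (Fin k × Option Tag))
  obtain ⟨s, hs⟩ := exists_clone_symbol.{u} (Tag := Tag) (k := k) (Nat.card (Fin k × Option Tag))
  refine ⟨Formula.iExs Unit (s.formula₂ (Term.var (Sum.inl j)) (Term.var (Sum.inr ())) ⊓
    r.formula₂ (Term.var (Sum.inl i)) (Term.var (Sum.inr ()))), fun D v => ?_⟩
  rw [Formula.realize_iExs]
  simp only [Formula.realize_inf, Formula.realize_rel₂, Term.realize_var]
  refine (exists_congr fun w => and_congr (hs D _ _) (hr D _ _)).trans ?_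
  constructor
  · rintro ⟨w, h, -, h'⟩
    exact (show (v j).1 = (w ()).1 from h) ▸ h'
  · exact fun h => ⟨fun _ => ((v j).1, (v i).2), rfl, rfl, h⟩

end UDef

/-- Structures that are definable in the copies of marked graphs, uniformly, are outputs of a
single transduction of the underlying graphs. -/
theorem exists_transduction {Tag : Type} [Finite Tag] {k : ℕ}
    {L : FirstOrder.Language.{0, 0}} [L.IsRelational] [Finite (Σ n, L.Relations n)]
    {dom : ∀ D : MarkedGraph.{u} Tag, (Fin 1 → D.Copies k) → Prop} (hdom : UDef dom)
    {rel : ∀ {n : ℕ}, L.Relations n → ∀ D : MarkedGraph.{u} Tag, (Fin n → D.Copies k) → Prop}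
    (hrel : ∀ {n : ℕ} (r : L.Relations n), UDef (rel r)) :
    ∃ T : Transduction FirstOrder.Language.graph L, ∀ (D : MarkedGraph.{u} Tag) (M : Type u)
      [L.Structure M] (f : M → D.Copies k), Function.Injective f →
      (∀ w, dom D ![w] ↔ w ∈ Set.range f) →
      (∀ {n : ℕ} (r : L.Relations n) (xs : Fin n → M), RelMap r xs ↔ rel r D (f ∘ xs)) →
      letI := D.G.structure
      T.Outputs D.V M (fun x => (f x).1) := by
  obtain ⟨δ, hδ⟩ := hdom
  choose ρ hρ using @hrel
  let I : Interpretation (copiesLang Tag k) L := ⟨δ, ρ⟩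
  refine ⟨Transduction.comp (colorTransduction k _) (Transduction.interp I), ?_⟩
  intro D M _ f hf hd hr
  refine ⟨D.Copies k, inferInstance, Prod.fst, f, colorTransduction_outputs D _, ?_, rfl⟩
  have hmem : ∀ x, I.dom.Realize ![f x] := fun x => (hδ D _).2 ((hd _).2 ⟨x, rfl⟩)
  let e : M ≃ I.Carrier (D.Copies k) := Equiv.ofBijective (fun x => ⟨f x, hmem x⟩)
    ⟨fun x y h => hf (congrArg Subtype.val h), fun w => by
      obtain ⟨x, hx⟩ := (hd w.1).1 ((hδ D _).1 w.2)
      exact ⟨x, Subtype.ext hx⟩⟩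
  exact ⟨⟨e, fun g => isEmptyElim g, fun r xs => (hρ r D _).trans (hr r xs).symm⟩, fun _ => rfl⟩


/-! ### Short connections in graphs without induced paths on seven vertices -/

section Linked

variable {V : Type u} (R : V → V → Prop) (X : V → Prop)

/-- There is an `R`-walk with at most `n` steps from `x` to `y`, whose vertices after `x` are
in `X`. -/
def Linked : ℕ → V → V → Prop
  | 0, x, y => x = y
  | n + 1, x, y => x = y ∨ ∃ z, X z ∧ R x z ∧ Linked n z y

variable {R X}

theorem Linked.refl : ∀ (n : ℕ) (x : V), Linked R X n x x
  | 0, _ => rfl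
  | _ + 1, _ => Or.inl rfl

theorem Linked.single {x y : V} (hy : X y) (h : R x y) : Linked R X 1 x y :=
  Or.inr ⟨y, hy, h, rfl⟩

theorem Linked.succ {n : ℕ} {x y : V} (h : Linked R X n x y) : Linked R X (n + 1) x y := by
  induction n generalizing x with
  | zero => exact Or.inl h
  | succ n ih =>
    rcases h with rfl | ⟨z, hz, hr, h⟩
    · exact Or.inl rfl
    · exact Or.inr ⟨z, hz, hr, ih h⟩

theorem Linked.mono {m n : ℕ} (h : m ≤ n) {x y : V} (hl : Linked R X m x y) :
    Linked R X n x y := by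
  induction h with
  | refl => exact hl
  | step _ ih => exact ih.succ

theorem Linked.trans {m n : ℕ} {x y z : V} (h : Linked R X m x y) (h' : Linked R X n y z) :
    Linked R X (m + n) x z := by
  induction m generalizing x with
  | zero => obtain rfl : x = y := h; simpa using h'
  | succ m ih =>
    rcases h with rfl | ⟨w, hw, hr, h⟩
    · exact h'.mono (Nat.le_add_left _ _)
    · rw [Nat.add_right_comm]
      exact Or.inr ⟨w, hw, hr, ih h⟩

/-- The conditions on `p 0, …, p 6` to be an induced path in a bipartite graph. -/
structure IsSevenPath (R : V → V → Prop) (p : Fin 7 → V) : Prop where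
  h01 : R (p 0) (p 1)
  h12 : R (p 1) (p 2)
  h23 : R (p 2) (p 3)
  h34 : R (p 3) (p 4)
  h45 : R (p 4) (p 5)
  h56 : R (p 5) (p 6)
  h03 : ¬ R (p 0) (p 3)
  h05 : ¬ R (p 0) (p 5)
  h14 : ¬ R (p 1) (p 4)
  h16 : ¬ R (p 1) (p 6)
  h25 : ¬ R (p 2) (p 5)
  h36 : ¬ R (p 3) (p 6)

/-- If no walk of at most five steps exists, a walk of six steps visits seven vertices `p 0, …, p
6`. Any chord between two of them at distance 3 or 5 along the walk would give a shorter walk, so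
they satisfy `IsSevenPath`. Chords at even distance do not matter: in the applications the graph is
bipartite. -/
theorem linked_five_of_linked_six (hP : ∀ p : Fin 7 → V, (∀ i, X (p i)) → ¬ IsSevenPath R p)
    {x y : V} (hx : X x) (h : Linked R X 6 x y) : Linked R X 5 x y := by
  by_contra hn
  rcases h with h | ⟨p1, hp1, r1, h1⟩
  · exact hn (Or.inl h)
  have s1 := Linked.single hp1 r1
  have h1' := h1
  rcases h1 with rfl | ⟨p2, hp2, r2, h2⟩
  · exact hn (s1.mono (by norm_num))
  have s2 := s1.trans (Linked.single hp2 r2)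
  have h2' := h2
  rcases h2 with rfl | ⟨p3, hp3, r3, h3⟩
  · exact hn (s2.mono (by norm_num))
  have s3 := s2.trans (Linked.single hp3 r3)
  have h3' := h3
  rcases h3 with rfl | ⟨p4, hp4, r4, h4⟩
  · exact hn (s3.mono (by norm_num))
  have s4 := s3.trans (Linked.single hp4 r4)
  have h4' := h4
  rcases h4 with rfl | ⟨p5, hp5, r5, h5⟩
  · exact hn (s4.mono (by norm_num))
  have s5 := s4.trans (Linked.single hp5 r5)
  have h5' := h5
  rcases h5 with rfl | ⟨p6, hp6, r6, h6⟩
  · exact hn s5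
  refine hP ![x, p1, p2, p3, p4, p5, p6] (by simp [Fin.forall_fin_succ, *])
    ⟨r1, r2, r3, r4, r5, r6, fun h => hn ?_, fun h => hn ?_, fun h => hn ?_, fun h => hn ?_,
      fun h => hn ?_, fun h => hn ?_⟩
  · exact ((Linked.single hp3 h).trans h3').mono (by norm_num)
  · exact ((Linked.single hp5 h).trans h5').mono (by norm_num)
  · exact ((s1.trans (Linked.single hp4 h)).trans h4').mono (by norm_num)
  · exact ((s1.trans (Linked.single hp6 h)).trans h6).mono (by norm_num)
  · exact ((s2.trans (Linked.single hp5 h)).trans h5').mono (by norm_num)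
  · exact ((s3.trans (Linked.single hp6 h)).trans h6).mono (by norm_num)

theorem linked_five_of_linked (hP : ∀ p : Fin 7 → V, (∀ i, X (p i)) → ¬ IsSevenPath R p)
    {n : ℕ} {x y : V} (hx : X x) (h : Linked R X n x y) : Linked R X 5 x y := by
  induction n generalizing x with
  | zero => exact Linked.mono (Nat.zero_le _) h
  | succ n ih =>
    rcases h with rfl | ⟨z, hz, hr, h⟩
    · exact Linked.refl _ _
    · exact linked_five_of_linked_six hP hx (Or.inr ⟨z, hz, hr, ih hz h⟩)

theorem exists_linked_iff_reachable {W : Type u} {H : SimpleGraph W} {x y : W} :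
    (∃ n, Linked H.Adj (fun _ => True) n x y) ↔ H.Reachable x y := by
  constructor
  · rintro ⟨n, h⟩
    induction n generalizing x with
    | zero => obtain rfl : x = y := h; rfl
    | succ n ih =>
      rcases h with rfl | ⟨z, -, hr, h⟩
      · rfl
      · exact hr.reachable.trans (ih h)
  · rintro ⟨p⟩
    induction p with
    | nil => exact ⟨0, rfl⟩
    | cons h p ih =>
      obtain ⟨n, hn⟩ := ih
      exact ⟨n + 1, Or.inr ⟨_, trivial, h, hn⟩⟩

theorem linked_iff_reachable_of_noSevenPath {W : Type u} {H : SimpleGraph W}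
    (hP : ∀ p : Fin 7 → W, ¬ IsSevenPath H.Adj p) {x y : W} :
    Linked H.Adj (fun _ => True) 5 x y ↔ H.Reachable x y := by
  rw [← exists_linked_iff_reachable]
  exact ⟨fun h => ⟨5, h⟩, fun ⟨_, h⟩ => linked_five_of_linked (fun p _ => hP p) trivial h⟩

end Linked

/-! ### The tree of a T-model -/

section Tree

variable (n : ℕ) {M : Type u} [(tLang n).Structure M]

/-- The number of proper ancestors of a node. -/
noncomputable def level (u : M) : ℕ := {y : M | Le n y u ∧ y ≠ u}.ncard

/-- The number of nodes that are to the left of a node among its siblings. -/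
noncomputable def pos (c : M) : ℕ := {z : M | Lt n z c}.ncard

variable {n} (hM : IsTModel n M)
include hM

namespace IsTModel

theorem level_lt {u v : M} (h : Le n u v) (hne : u ≠ v) : level n u < level n v := by
  have := hM.finite
  refine Set.ncard_lt_ncard ⟨fun y hy => ⟨hM.le_trans _ _ _ hy.1 h, ?_⟩, fun hs => ?_⟩
    (Set.toFinite _)
  · rintro rfl
    exact hne (hM.le_antisymm _ _ h hy.1)
  · exact (hs (show u ∈ _ from ⟨h, hne⟩)).2 rfl

theorem level_le {u v : M} (h : Le n u v) : level n u ≤ level n v := by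
  by_cases e : u = v
  · rw [e]
  · exact (hM.level_lt h e).le

theorem le_of_level_le {u v x : M} (hu : Le n u x) (hv : Le n v x)
    (h : level n u ≤ level n v) : Le n u v := by
  rcases hM.chain _ _ _ hu hv with h' | h'
  · exact h'
  · by_cases e : v = u
    · rw [e]; exact hM.le_refl _
    · exact absurd (hM.level_lt h' e) (not_lt.2 h)

theorem eq_of_level_eq {u v x : M} (hu : Le n u x) (hv : Le n v x)
    (h : level n u = level n v) : u = v :=
  hM.le_antisymm _ _ (hM.le_of_level_le hu hv h.le) (hM.le_of_level_le hv hu h.ge)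

/-- The proper ancestors of `v` are `u` and the proper ancestors of `u`, since ancestors of `v` form
a chain and nothing lies strictly between `u` and `v`. -/
theorem level_child {u v : M} (h : Child n u v) : level n v = level n u + 1 := by
  have := hM.finite
  rw [level, level, ← Set.ncard_insert_of_notMem (a := u) (fun h => h.2 rfl) (Set.toFinite _)]
  congr 1
  ext y
  simp only [Set.mem_ofPred_eq, Set.mem_insert_iff]
  constructor
  · rintro ⟨hy, hne⟩
    by_cases e : y = u
    · exact Or.inl e
    · rcases hM.chain _ _ _ hy h.1 with h' | h'
      · exact Or.inr ⟨h', e⟩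
      · rcases h.2.2 y h' hy with e' | e'
        · exact Or.inl e'
        · exact absurd e' hne
  · rintro (rfl | ⟨hy, hne⟩)
    · exact ⟨h.1, h.2.1⟩
    · refine ⟨hM.le_trans _ _ _ hy h.1, ?_⟩
      rintro rfl
      exact hne (hM.le_antisymm _ _ hy h.1)

theorem exists_child {u x : M} (h : Le n u x) (hne : u ≠ x) :
    ∃ c, Child n u c ∧ Le n c x := by
  have := hM.finite
  obtain ⟨c, ⟨hc, hcx, hcu⟩, hmin⟩ := Set.exists_min_image
    {z : M | Le n u z ∧ Le n z x ∧ z ≠ u} (level n) (Set.toFinite _)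
    ⟨x, h, hM.le_refl x, hne.symm⟩
  refine ⟨c, ⟨hc, hcu.symm, fun z hz hzc => ?_⟩, hcx⟩
  by_contra! hcon
  exact absurd (hM.level_lt hzc hcon.2)
    (not_lt.2 (hmin z ⟨hz, hM.le_trans _ _ _ hzc hcx, hcon.1⟩))

theorem exists_parent {v : M} {d : ℕ} (h : level n v = d + 1) :
    ∃ u, Child n u v ∧ level n u = d := by
  have := hM.finite
  have hne : {y : M | Le n y v ∧ y ≠ v}.Nonempty := by
    rw [← Set.ncard_pos (Set.toFinite _)]
    change 0 < level n v
    omega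
  obtain ⟨u, ⟨hu, huv⟩, hmax⟩ := Set.exists_max_image _ (level n) (Set.toFinite _) hne
  have hc : Child n u v := by
    refine ⟨hu, huv, fun z hz hzv => ?_⟩
    by_contra! hcon
    exact absurd (hM.level_lt hz hcon.1.symm) (not_lt.2 (hmax z ⟨hzv, hcon.2⟩))
  exact ⟨u, hc, by have := hM.level_child hc; omega⟩

theorem parent_unique {u u' v : M} (h : Child n u v) (h' : Child n u' v) : u = u' :=
  hM.eq_of_level_eq h.1 h'.1 (by have := hM.level_child h; have := hM.level_child h'; omega)

theorem child_unique {u c c' x : M} (h : Child n u c) (h' : Child n u c') (hx : Le n c x)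
    (hx' : Le n c' x) : c = c' :=
  hM.eq_of_level_eq hx hx' (by rw [hM.level_child h, hM.level_child h'])

theorem le_of_level_eq_zero {u : M} (h : level n u = 0) (x : M) : Le n u x := by
  obtain ⟨r, hr⟩ := hM.root
  by_cases e : r = u
  · exact e ▸ hr x
  · have := hM.level_lt (hr u) e
    omega

theorem exists_level_eq_zero (x : M) : ∃ u : M, level n u = 0 ∧ Le n u x := by
  obtain ⟨r, hr⟩ := hM.root
  refine ⟨r, ?_, hr x⟩
  have : {y : M | Le n y r ∧ y ≠ r} = ∅ :=
    Set.eq_empty_of_forall_notMem fun y hy => hy.2 (hM.le_antisymm _ _ hy.1 (hr y))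
  rw [level, this, Set.ncard_empty]

theorem exists_leaf (u : M) : ∃ x : M, Leaf n x ∧ Le n u x := by
  have := hM.finite
  obtain ⟨x, hx, hmax⟩ := Set.exists_max_image {x : M | Le n u x} (level n) (Set.toFinite _)
    ⟨u, hM.le_refl u⟩
  refine ⟨x, (hM.leaf_iff x).2 fun y hy => ?_, hx⟩
  by_contra hne
  exact absurd (hM.level_lt hy (Ne.symm hne)) (not_lt.2 (hmax y (hM.le_trans _ _ _ hx hy)))

theorem not_leaf_of_child {u v : M} (h : Child n u v) : ¬ Leaf n u := fun hl =>
  h.2.1 ((hM.leaf_iff u).1 hl v h.1).symm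

/-- The inequality is strict because the level counts proper ancestors, while the height also counts
the leaf itself. -/
theorem level_lt_of_height {h : ℕ} (hh : HeightLE n M h) (u : M) : level n u < h := by
  have := hM.finite
  obtain ⟨x, hx, hux⟩ := hM.exists_leaf u
  refine (hM.level_le hux).trans_lt (lt_of_lt_of_le ?_ (hh x hx))
  refine Set.ncard_lt_ncard ⟨fun y hy => hy.1, fun hs => ?_⟩ (Set.toFinite _)
  exact (hs (show x ∈ {y | Le n y x} from hM.le_refl x)).2 rfl

theorem pos_lt {c c' : M} (h : Lt n c c') : pos n c < pos n c' := by
  have := hM.finite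
  exact Set.ncard_lt_ncard ⟨fun y hy => hM.lt_trans _ _ _ hy h,
    fun hs => hM.lt_irrefl c (hs (show c ∈ {z | Lt n z c'} from h))⟩ (Set.toFinite _)

theorem lt_iff_pos_lt {m c c' : M} (hm : Ordered n m) (hc : Child n m c) (hc' : Child n m c') :
    Lt n c c' ↔ pos n c < pos n c' := by
  refine ⟨hM.pos_lt, fun h => ?_⟩
  rcases (hM.lt_total c c').2 ⟨by rintro rfl; omega, m, hm, hc, hc'⟩ with h' | h'
  · exact h'
  · have := hM.pos_lt h'
    omega

theorem eq_of_pos_eq {m c c' : M} (hm : Ordered n m) (hc : Child n m c) (hc' : Child n m c')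
    (h : pos n c = pos n c') : c = c' := by
  by_contra hne
  rcases (hM.lt_total c c').2 ⟨hne, m, hm, hc, hc'⟩ with h' | h' <;>
  · have := hM.pos_lt h'
    omega

theorem parent_of_lt {c c' : M} (h : Lt n c c') :
    ∃ m, Ordered n m ∧ Child n m c ∧ Child n m c' :=
  ((hM.lt_total c c').1 (Or.inl h)).2

/-- Positions of siblings have no gaps: `pos` maps the left siblings of `c` injectively into the
numbers below `pos n c`, and there are exactly `pos n c` of them. -/
theorem exists_pos_eq {m c : M} (hm : Ordered n m) (hc : Child n m c) {i : ℕ}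
    (hi : i < pos n c) : ∃ z, Child n m z ∧ pos n z = i := by
  have := hM.finite
  have hchild : ∀ z, Lt n z c → Child n m z := by
    intro z hz
    obtain ⟨m', -, h1, h2⟩ := hM.parent_of_lt hz
    exact hM.parent_unique h2 hc ▸ h1
  have himg : pos n '' {z : M | Lt n z c} = Set.Iio (pos n c) := by
    refine Set.eq_of_subset_of_ncard_le ?_ ?_ (Set.finite_Iio _)
    · rintro _ ⟨z, hz, rfl⟩
      exact hM.pos_lt hz
    · have hinj : Set.InjOn (pos n) {z : M | Lt n z c} := fun z hz z' hz' h =>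
        hM.eq_of_pos_eq hm (hchild z hz) (hchild z' hz') h
      rw [hinj.ncard_image]
      simp [← Finset.coe_Iio, pos]
  obtain ⟨z, hz, rfl⟩ := himg.symm ▸ (show i ∈ Set.Iio (pos n c) from hi)
  exact ⟨z, hchild z hz, rfl⟩

theorem le_of_le_of_le {u c c' x y z : M} (hc : Child n u c) (hc' : Child n u c')
    (hne : c ≠ c') (hx : Le n c x) (hy : Le n c' y) (hzx : Le n z x) (hzy : Le n z y) :
    Le n z u := by
  -- Otherwise `y` would lie above both `c` and `c'`.
  have key : ¬ Le n c z := fun h =>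
    hne (hM.child_unique hc hc' (hM.le_trans _ _ _ h hzy) hy)
  rcases hM.chain _ _ _ hzx hx with h | h
  · rcases hM.chain _ _ _ h hc.1 with h' | h'
    · exact h'
    · rcases hc.2.2 z h' h with rfl | rfl
      · exact hM.le_refl _
      · exact absurd (hM.le_refl _) key
  · exact absurd h key

/-- The infimum of `x` and `y` is `u`. Two ancestors `a`, `b` compared by `◁` are distinct children
of some node, which must also be this infimum, so `a` and `b` are `c` and `c'`. -/
theorem Lambda_iff {u c c' x y : M} (hc : Child n u c) (hc' : Child n u c')
    (hne : c ≠ c') (hx : Le n c x) (hy : Le n c' y) :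
    Lambda n x y ↔ (Unordered n u ∨ (Ordered n u ∧ Lt n c c')) ∧
      ∃ i j : Fin n, Gamma i x ∧ Gamma j y ∧ Kappa i j u := by
  have hux := hM.le_trans _ _ _ hc.1 hx
  have huy := hM.le_trans _ _ _ hc'.1 hy
  have hxy : x ≠ y := by
    rintro rfl
    exact hne (hM.child_unique hc hc' hx hy)
  constructor
  · rintro ⟨m, ⟨hmx, hmy, hm⟩, ht, hk⟩
    obtain rfl : m = u := hM.le_antisymm _ _ (hM.le_of_le_of_le hc hc' hne hx hy hmx hmy)
      (hm u hux huy)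
    refine ⟨ht.imp And.left ?_, hk⟩
    rintro ⟨ho, a, b, ha, hb, hab⟩
    refine ⟨ho, ?_⟩
    obtain ⟨v, -, hva, hvb⟩ := hM.parent_of_lt hab
    have hab' : a ≠ b := fun e => hM.lt_irrefl b (e ▸ hab)
    have h1 := hM.le_of_le_of_le hva hvb hab' ha hb hux huy
    have h2 := hM.le_of_le_of_le hc hc' hne hx hy (hM.le_trans _ _ _ hva.1 ha)
      (hM.le_trans _ _ _ hvb.1 hb)
    obtain rfl := hM.le_antisymm _ _ h1 h2
    rwa [hM.child_unique hc hva hx ha, hM.child_unique hc' hvb hy hb]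
  · rintro ⟨ht, hk⟩
    refine ⟨u, ⟨hux, huy, fun z => hM.le_of_le_of_le hc hc' hne hx hy⟩, ?_, hk⟩
    exact ht.imp (fun h => ⟨h, hxy⟩) fun h => ⟨h.1, c, c', hx, hy, h.2⟩

end IsTModel

end Tree


/-! ### Adjacency in bicotrees -/

theorem IsSevenPath.comap {V W : Type*} {R : W → W → Prop} {f : V → W} {p : Fin 7 → V}
    (h : IsSevenPath (fun x y => R (f x) (f y)) p) : IsSevenPath R (f ∘ p) :=
  ⟨h.h01, h.h12, h.h23, h.h34, h.h45, h.h56, h.h03, h.h05, h.h14, h.h16, h.h25, h.h36⟩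

/-- The four rules are those of a U-node, a B-node, an O-node, and an O-node after bipartite
complementation; `a i` is the rank of the child that contains the `i`-th vertex. The path is
connected, and so is its bipartite complement, which is the path 4-1-6-3-0-5-2. For the last two
rules, draw an arrow for each inequality: edges are oriented from one color class to the other and
non-edges between the classes the opposite way, and the resulting digraph is strongly connected. In
every case all ranks agree. -/
theorem IsSevenPath.constant_of_rule {S : Fin 7 → Fin 7 → Prop} (hp : IsSevenPath S id)
    (hS : ∀ i j, S i j → S j i) {Z : Fin 7 → Prop} (hZ : ∀ i j, S i j → (Z i ↔ ¬ Z j))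
    {a : Fin 7 → ℕ}
    (h : (∀ i j, Z i → ¬ Z j → S i j → a i = a j) ∨
      (∀ i j, Z i → ¬ Z j → ¬ S i j → a i = a j) ∨
      (∀ i j, Z i → ¬ Z j → (S i j → a i ≤ a j) ∧ (¬ S i j → a j ≤ a i)) ∨
      (∀ i j, Z i → ¬ Z j → (S i j → a j ≤ a i) ∧ (¬ S i j → a i ≤ a j))) (i : Fin 7) :
    a i = a 0 := by
  obtain ⟨h01, h12, h23, h34, h45, h56, h03, h05, h14, h16, h25, h36⟩ := hp
  simp only [id] at *
  have z1 := hZ _ _ h01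
  have z2 := hZ _ _ h12
  have z3 := hZ _ _ h23
  have z4 := hZ _ _ h34
  have z5 := hZ _ _ h45
  have z6 := hZ _ _ h56
  have key : a 1 = a 0 ∧ a 2 = a 0 ∧ a 3 = a 0 ∧ a 4 = a 0 ∧ a 5 = a 0 ∧ a 6 = a 0 := by
    -- Colors alternate along the path, so the color of vertex 0 determines all of them.
    by_cases z0 : Z 0
    · have y1 : ¬ Z 1 := z1.1 z0
      have y2 : Z 2 := by_contra fun h => y1 (z2.2 h)
      have y3 : ¬ Z 3 := z3.1 y2
      have y4 : Z 4 := by_contra fun h => y3 (z4.2 h)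
      have y5 : ¬ Z 5 := z5.1 y4
      have y6 : Z 6 := by_contra fun h => y5 (z6.2 h)
      rcases h with h | h | h | h
      · have := h _ _ z0 y1 h01
        have := h _ _ y2 y1 (hS _ _ h12)
        have := h _ _ y2 y3 h23
        have := h _ _ y4 y3 (hS _ _ h34)
        have := h _ _ y4 y5 h45
        have := h _ _ y6 y5 (hS _ _ h56)
        omega
      · have := h _ _ z0 y3 h03
        have := h _ _ z0 y5 h05
        have := h _ _ y4 y1 (mt (hS _ _) h14)
        have := h _ _ y6 y1 (mt (hS _ _) h16)
        have := h _ _ y2 y5 h25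
        have := h _ _ y6 y3 (mt (hS _ _) h36)
        omega
      all_goals
        have := (h _ _ z0 y1).1 h01
        have := (h _ _ y2 y1).1 (hS _ _ h12)
        have := (h _ _ y2 y3).1 h23
        have := (h _ _ y4 y3).1 (hS _ _ h34)
        have := (h _ _ y4 y5).1 h45
        have := (h _ _ y6 y5).1 (hS _ _ h56)
        have := (h _ _ z0 y3).2 h03
        have := (h _ _ z0 y5).2 h05
        have := (h _ _ y4 y1).2 (mt (hS _ _) h14)
        have := (h _ _ y6 y1).2 (mt (hS _ _) h16)
        have := (h _ _ y2 y5).2 h25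
        have := (h _ _ y6 y3).2 (mt (hS _ _) h36)
        omega
    · have y1 : Z 1 := by_contra fun h => z0 (z1.2 h)
      have y2 : ¬ Z 2 := z2.1 y1
      have y3 : Z 3 := by_contra fun h => y2 (z3.2 h)
      have y4 : ¬ Z 4 := z4.1 y3
      have y5 : Z 5 := by_contra fun h => y4 (z5.2 h)
      have y6 : ¬ Z 6 := z6.1 y5
      rcases h with h | h | h | h
      · have := h _ _ y1 z0 (hS _ _ h01)
        have := h _ _ y1 y2 h12
        have := h _ _ y3 y2 (hS _ _ h23)
        have := h _ _ y3 y4 h34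
        have := h _ _ y5 y4 (hS _ _ h45)
        have := h _ _ y5 y6 h56
        omega
      · have := h _ _ y3 z0 (mt (hS _ _) h03)
        have := h _ _ y5 z0 (mt (hS _ _) h05)
        have := h _ _ y1 y4 h14
        have := h _ _ y1 y6 h16
        have := h _ _ y5 y2 (mt (hS _ _) h25)
        have := h _ _ y3 y6 h36
        omega
      all_goals
        have := (h _ _ y1 z0).1 (hS _ _ h01)
        have := (h _ _ y1 y2).1 h12
        have := (h _ _ y3 y2).1 (hS _ _ h23)
        have := (h _ _ y3 y4).1 h34
        have := (h _ _ y5 y4).1 (hS _ _ h45)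
        have := (h _ _ y5 y6).1 h56
        have := (h _ _ y3 z0).2 (mt (hS _ _) h03)
        have := (h _ _ y5 z0).2 (mt (hS _ _) h05)
        have := (h _ _ y1 y4).2 h14
        have := (h _ _ y1 y6).2 h16
        have := (h _ _ y5 y2).2 (mt (hS _ _) h25)
        have := (h _ _ y3 y6).2 h36
        omega
  fin_cases i
  · rfl
  · exact key.1
  · exact key.2.1
  · exact key.2.2.1
  · exact key.2.2.2.1
  · exact key.2.2.2.2.1
  · exact key.2.2.2.2.2

section

variable {M : Type u} [(tLang 2).Structure M]

/-- Adjacency in the graph modeled by `M`. -/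
def BAdj (x y : M) : Prop := Lambda 2 x y ∨ Lambda 2 y x

/-- The leaves of the first color. -/
def Zero (x : M) : Prop := Gamma (n := 2) 0 x

/-- Adjacency in the bipartite complement of the graph modeled by `M`. -/
def CoAdj (x y : M) : Prop := (Zero x ↔ ¬ Zero y) ∧ ¬ BAdj x y

theorem BAdj.symm {x y : M} (h : BAdj x y) : BAdj y x := Or.symm h

theorem CoAdj.symm {x y : M} (h : CoAdj x y) : CoAdj y x :=
  ⟨by have := h.1; tauto, fun h' => h.2 h'.symm⟩

/-- `x` and `y` are leaves of the first and second color below the children `c` and `c'` of `u`. -/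
structure OppositeLeaves (u x y c c' : M) : Prop where
  leaf_left : Leaf 2 x
  leaf_right : Leaf 2 y
  zero : Zero x
  not_zero : ¬ Zero y
  child_left : Child 2 u c
  child_right : Child 2 u c'
  le_left : Le 2 c x
  le_right : Le 2 c' y

/-- At the deepest common ancestor of the seven leaves, `IsSevenPath.constant_of_rule` puts all of
them below a single child, which is a deeper common ancestor. The relation `R` is kept general so
that the graph and its bipartite complement are treated together. -/
theorem IsTModel.not_isSevenPath (hM : IsTModel 2 M) {R : M → M → Prop}
    (hR : ∀ x y, R x y → R y x)
    (hcol : ∀ x y, Leaf 2 x → Leaf 2 y → R x y → (Zero x ↔ ¬ Zero y))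
    (hrank : ∀ u : M, ¬ Leaf 2 u → ∃ g : M → ℕ,
      (∀ c c', Child 2 u c → Child 2 u c' → g c = g c' → c = c') ∧
      ((∀ x y c c', OppositeLeaves u x y c c' → R x y → g c = g c') ∨
        (∀ x y c c', OppositeLeaves u x y c c' → ¬ R x y → g c = g c') ∨
        (∀ x y c c', OppositeLeaves u x y c c' →
          (R x y → g c ≤ g c') ∧ (¬ R x y → g c' ≤ g c)) ∨
        (∀ x y c c', OppositeLeaves u x y c c' →
          (R x y → g c' ≤ g c) ∧ (¬ R x y → g c ≤ g c'))))
    (p : Fin 7 → M) (hp : ∀ i, Leaf 2 (p i)) : ¬ IsSevenPath R p := by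
  intro h
  have := hM.finite
  obtain ⟨r, hr⟩ := hM.root
  obtain ⟨u, hu, hmax⟩ := Set.exists_max_image {u : M | ∀ i, Le 2 u (p i)} (level 2)
    (Set.toFinite _) ⟨r, fun i => hr _⟩
  have hul : ¬ Leaf 2 u := by
    intro hl
    have h0 := (hM.leaf_iff u).1 hl _ (hu 0)
    have h1 := (hM.leaf_iff u).1 hl _ (hu 1)
    have := hcol _ _ (hp 0) (hp 1) h.h01
    rw [h0, h1] at this
    tauto
  have hc : ∀ i, ∃ c, Child 2 u c ∧ Le 2 c (p i) := fun i =>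
    hM.exists_child (hu i) fun e => hul (e ▸ hp i)
  choose c hc hcp using hc
  obtain ⟨g, hg, hrule⟩ := hrank u hul
  have hopp : ∀ i j, Zero (p i) → ¬ Zero (p j) → OppositeLeaves u (p i) (p j) (c i) (c j) :=
    fun i j hi hj => ⟨hp i, hp j, hi, hj, hc i, hc j, hcp i, hcp j⟩
  have hconst := IsSevenPath.constant_of_rule (S := fun i j => R (p i) (p j))
    ⟨h.h01, h.h12, h.h23, h.h34, h.h45, h.h56, h.h03, h.h05, h.h14, h.h16, h.h25, h.h36⟩
    (fun i j => hR _ _) (Z := fun i => Zero (p i)) (fun i j => hcol _ _ (hp i) (hp j))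
    (a := fun i => g (c i)) (by
      rcases hrule with h | h | h | h
      · exact Or.inl fun i j hi hj => h _ _ _ _ (hopp i j hi hj)
      · exact Or.inr (Or.inl fun i j hi hj => h _ _ _ _ (hopp i j hi hj))
      · exact Or.inr (Or.inr (Or.inl fun i j hi hj => h _ _ _ _ (hopp i j hi hj)))
      · exact Or.inr (Or.inr (Or.inr fun i j hi hj => h _ _ _ _ (hopp i j hi hj))))
  have hall : ∀ i, Le 2 (c 0) (p i) := fun i => by
    rw [← hg _ _ (hc i) (hc 0) (hconst i)]
    exact hcp i
  have := hmax (c 0) hall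
  have := hM.level_child (hc 0)
  omega

/-! ### Adjacency across the children of a node, and excluded seven-vertex paths. -/

namespace IsBicotree

variable (hM : IsBicotree M)
include hM

theorem gamma_one_iff {x : M} (hx : Leaf 2 x) : Gamma (n := 2) 1 x ↔ ¬ Zero x := by
  obtain ⟨i, hi, huniq⟩ := hM.gamma_leaf x hx
  constructor
  · intro h h'
    exact absurd ((huniq _ h).trans (huniq _ h').symm) (by decide)
  · intro h
    match i, hi with
    | 0, hi => exact absurd hi h
    | 1, hi => exact hi

theorem colors_of_kappa {m x y : M} (hm : ¬ Leaf 2 m) (hx : Leaf 2 x) (hy : Leaf 2 y)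
    (h : ∃ i j : Fin 2, Gamma i x ∧ Gamma j y ∧ Kappa i j m) : Zero x ↔ ¬ Zero y := by
  obtain ⟨i, j, hi, hj, hk⟩ := h
  have hne : i ≠ j := by
    rcases hM.types m hm with h | h | h
    · exact absurd hk (h.2 i j)
    · exact (h.2 i j).1 hk
    · exact ((h.2 i j).1 hk).ne
  have hgx := hM.gamma_one_iff hx
  have hgy := hM.gamma_one_iff hy
  match i, j, hi, hj with
  | 0, 0, _, _ => exact absurd rfl hne
  | 1, 1, _, _ => exact absurd rfl hne
  | 0, 1, hi, hj => exact ⟨fun _ => hgy.1 hj, fun _ => hi⟩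
  | 1, 0, hi, hj => exact ⟨fun h => absurd h (hgx.1 hi), fun h => absurd hj h⟩

theorem colors_of_bAdj {x y : M} (hx : Leaf 2 x) (hy : Leaf 2 y) (h : BAdj x y) :
    Zero x ↔ ¬ Zero y := by
  have key : ∀ {x y : M}, Leaf 2 x → Leaf 2 y → Lambda 2 x y → (Zero x ↔ ¬ Zero y) := by
    rintro x y hx hy ⟨m, -, ht, hk⟩
    exact hM.colors_of_kappa ((hM.internal m).2 (ht.imp And.left And.left)) hx hy hk
  rcases h with h | h
  · exact key hx hy h
  · have := key hy hx h
    tauto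

theorem bAdj_ne {x y : M} (hx : Leaf 2 x) (hy : Leaf 2 y) (h : BAdj x y) : x ≠ y := by
  rintro rfl
  have := hM.colors_of_bAdj hx hy h
  tauto

theorem kappa_iff {u x y : M} (hx : Leaf 2 x) (hy : Leaf 2 y) (hzx : Zero x) (hzy : ¬ Zero y) :
    (∃ i j : Fin 2, Gamma i x ∧ Gamma j y ∧ Kappa i j u) ↔ Kappa (n := 2) 0 1 u := by
  have hgx := hM.gamma_one_iff hx
  have hgy := hM.gamma_one_iff hy
  constructor
  · rintro ⟨i, j, hi, hj, hk⟩
    match i, j, hi, hj, hk with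
    | 0, 1, _, _, hk => exact hk
    | 0, 0, _, hj, _ => exact absurd hj hzy
    | 1, _, hi, _, _ => exact absurd hzx (hgx.1 hi)
  · exact fun h => ⟨0, 1, hzx, hgy.2 hzy, h⟩

theorem not_bAdj_of_isU {u x y c c' : M} (hu : IsU u) (h : OppositeLeaves u x y c c')
    (hne : c ≠ c') : ¬ BAdj x y := by
  rintro (h' | h')
  · rw [hM.Lambda_iff h.child_left h.child_right hne h.le_left h.le_right] at h'
    obtain ⟨-, i, j, -, -, hk⟩ := h'
    exact hu.2 i j hk
  · rw [hM.Lambda_iff h.child_right h.child_left hne.symm h.le_right h.le_left] at h'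
    obtain ⟨-, i, j, -, -, hk⟩ := h'
    exact hu.2 i j hk

theorem bAdj_of_isB {u x y c c' : M} (hu : IsB u) (h : OppositeLeaves u x y c c')
    (hne : c ≠ c') : BAdj x y := by
  refine Or.inl ((hM.Lambda_iff h.child_left h.child_right hne h.le_left h.le_right).2
    ⟨Or.inl hu.1, ?_⟩)
  rw [hM.kappa_iff h.leaf_left h.leaf_right h.zero h.not_zero, hu.2]
  decide

/-- Only `λ(x, y)` can hold, because `κ_u(1, 0) = ⊥`; it holds exactly when `c ◁ c'`. -/
theorem bAdj_iff_of_isO {u x y c c' : M} (hu : IsO u) (h : OppositeLeaves u x y c c')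
    (hne : c ≠ c') : BAdj x y ↔ pos 2 c < pos 2 c' := by
  have hnu : ¬ Unordered 2 u := fun h => hM.unordered_not_ordered u h hu.1
  have h1 := hM.Lambda_iff h.child_left h.child_right hne h.le_left h.le_right
  have h2 := hM.Lambda_iff h.child_right h.child_left hne.symm h.le_right h.le_left
  have h3 : ¬ ∃ i j : Fin 2, Gamma i y ∧ Gamma j x ∧ Kappa i j u := by
    rintro ⟨i, j, hi, hj, hk⟩
    have hgx := hM.gamma_one_iff h.leaf_left
    have hlt := (hu.2 i j).1 hk
    match i, j, hi, hj with
    | 0, _, hi, _ => exact h.not_zero hi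
    | 1, 1, _, hj => exact hgx.1 hj h.zero
    | 1, 0, _, _ => exact absurd hlt (by decide)
  have hk : Kappa (n := 2) 0 1 u := (hu.2 0 1).2 (by decide)
  rw [BAdj, h1, h2, hM.kappa_iff h.leaf_left h.leaf_right h.zero h.not_zero,
    ← hM.lt_iff_pos_lt hu.1 h.child_left h.child_right]
  have ho := hu.1
  simp only [hnu, ho, h3, hk, false_or, true_and, and_true, and_false, or_false]

theorem exists_injective_rank : ∃ g : M → ℕ, Function.Injective g := by
  have := hM.finite
  exact ⟨fun x => Finite.equivFin M x, fun x y h => (Finite.equivFin M).injective (Fin.ext h)⟩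

theorem bAdj_pos_le {u x y c c' : M} (hu : IsO u) (h : OppositeLeaves u x y c c') :
    (BAdj x y → pos 2 c ≤ pos 2 c') ∧ (¬ BAdj x y → pos 2 c' ≤ pos 2 c) := by
  by_cases e : c = c'
  · simp [e]
  · rw [hM.bAdj_iff_of_isO hu h e]
    exact ⟨le_of_lt, not_lt.1⟩

theorem not_isSevenPath_bAdj (p : Fin 7 → M) (hp : ∀ i, Leaf 2 (p i)) :
    ¬ IsSevenPath BAdj p := by
  obtain ⟨g, hg⟩ := hM.exists_injective_rank
  refine hM.toIsTModel.not_isSevenPath (fun _ _ => BAdj.symm)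
    (fun x y hx hy => hM.colors_of_bAdj hx hy) (fun u hu => ?_) p hp
  rcases hM.types u hu with h | h | h
  · refine ⟨g, fun _ _ _ _ e => hg e, Or.inl fun x y c c' ho hr => ?_⟩
    by_contra hne
    exact hM.not_bAdj_of_isU h ho (fun e => hne (congrArg g e)) hr
  · refine ⟨g, fun _ _ _ _ e => hg e, Or.inr (Or.inl fun x y c c' ho hr => ?_)⟩
    by_contra hne
    exact hr (hM.bAdj_of_isB h ho fun e => hne (congrArg g e))
  · exact ⟨pos 2, fun _ _ hc hc' e => hM.eq_of_pos_eq h.1 hc hc' e,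
      Or.inr (Or.inr (Or.inl fun x y c c' ho => hM.bAdj_pos_le h ho))⟩

/-- Bipartite complementation exchanges the rules of U-nodes and B-nodes and reverses the
inequalities at O-nodes. -/
theorem not_isSevenPath_coAdj (p : Fin 7 → M) (hp : ∀ i, Leaf 2 (p i)) :
    ¬ IsSevenPath CoAdj p := by
  obtain ⟨g, hg⟩ := hM.exists_injective_rank
  have key : ∀ {u x y c c' : M}, OppositeLeaves u x y c c' → (CoAdj x y ↔ ¬ BAdj x y) :=
    fun ho => ⟨And.right, fun h => ⟨by have := ho.zero; have := ho.not_zero; tauto, h⟩⟩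
  refine hM.toIsTModel.not_isSevenPath (fun _ _ => CoAdj.symm)
    (fun x y hx hy h => h.1) (fun u hu => ?_) p hp
  rcases hM.types u hu with h | h | h
  · refine ⟨g, fun _ _ _ _ e => hg e, Or.inr (Or.inl fun x y c c' ho hr => ?_)⟩
    rw [key ho, not_not] at hr
    by_contra hne
    exact hM.not_bAdj_of_isU h ho (fun e => hne (congrArg g e)) hr
  · refine ⟨g, fun _ _ _ _ e => hg e, Or.inl fun x y c c' ho hr => ?_⟩
    rw [key ho] at hr
    by_contra hne
    exact hr (hM.bAdj_of_isB h ho fun e => hne (congrArg g e))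
  · refine ⟨pos 2, fun _ _ hc hc' e => hM.eq_of_pos_eq h.1 hc hc' e,
      Or.inr (Or.inr (Or.inr fun x y c c' ho => ?_))⟩
    rw [key ho, not_not]
    exact (hM.bAdj_pos_le h ho).symm

end IsBicotree

end


/-! ### Definability of the nodes of a clean bicotree -/

/-- The marks used to encode a bicotree in its set of leaves. -/
inductive Tag
  | rep
  | isU
  | isB
  | isO
  | pos (j : Fin 3)
  | zero
  | leaf
  | unordered
  | ordered
  | gamma (i : Fin 2)
  | kappa (i j : Fin 2)
  deriving Fintype

namespace MarkedGraph

section Encoding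

variable (D : MarkedGraph.{u} Tag)

/-- Adjacency in the bipartite complement with respect to the mark `zero`. -/
def CoAdj (x y : D.V) : Prop :=
  (D.mark 0 Tag.zero x ∧ ¬ D.mark 0 Tag.zero y ∨ ¬ D.mark 0 Tag.zero x ∧ D.mark 0 Tag.zero y) ∧
    ¬ D.G.Adj x y

/-- The ancestors of `x` and `y` at level `d` have the same position modulo `3`. -/
def SamePos (d : ℕ) (x y : D.V) : Prop :=
  ∃ j : Fin 3, D.mark d (Tag.pos j) x ∧ D.mark d (Tag.pos j) y

/-- The ordering of leaves of different colors below children of an ordered node, if the positions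
of these children differ modulo `3`. Here `S` is the equivalence of having the same ancestor at
level `d`. -/
def Prec (S : D.V → D.V → Prop) (d : ℕ) (x y : D.V) : Prop :=
  S x y ∧ ¬ D.SamePos (d + 1) x y ∧
    (D.mark 0 Tag.zero x ∧ ¬ D.mark 0 Tag.zero y ∧ D.G.Adj x y ∨
      ¬ D.mark 0 Tag.zero x ∧ D.mark 0 Tag.zero y ∧ ¬ D.G.Adj x y)

/-- Chains of at most three steps of `Prec`. -/
def Before (S : D.V → D.V → Prop) (d : ℕ) (x y : D.V) : Prop :=
  D.Prec S d x y ∨ (∃ z, D.Prec S d x z ∧ D.Prec S d z y) ∨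
    ∃ z, ∃ z', D.Prec S d x z ∧ D.Prec S d z z' ∧ D.Prec S d z' y

/-- The equivalence of having the same ancestor at level `d`. -/
def SameNode : ℕ → D.V → D.V → Prop
  | 0, _, _ => True
  | d + 1, x, y => SameNode d x y ∧
      (D.mark d Tag.isU x ∧ Linked D.G.Adj (SameNode d x) 5 x y ∨
        D.mark d Tag.isB x ∧ Linked D.CoAdj (SameNode d x) 5 x y ∨
        D.mark d Tag.isO x ∧ D.SamePos (d + 1) x y ∧ ¬ D.Before (SameNode d) d x y ∧
          ¬ D.Before (SameNode d) d y x)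

end Encoding

end MarkedGraph

/-- A binary relation on marked graphs is definable in their copies, uniformly. -/
def BinDef (k : ℕ) (R : ∀ D : MarkedGraph.{u} Tag, D.V → D.V → Prop) : Prop :=
  ∀ {α : Type} (i j : α), UDef (k := k) fun D v => R D (v i).1 (v j).1

theorem binDef_samePos {k : ℕ} {d : ℕ} (hd : d < k) : 
    BinDef.{u} k fun D => D.SamePos d := fun i j =>
  UDef.exists_finite fun c => (UDef.mark i hd (Tag.pos c)).and (UDef.mark j hd (Tag.pos c))

section Definability

variable {k : ℕ} [NeZero k]

theorem binDef_coAdj : BinDef.{u} k MarkedGraph.CoAdj := fun i j =>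
  have h := fun l => UDef.mark l (NeZero.pos k) Tag.zero
  (((h i).and (h j).not).or ((h i).not.and (h j))).and (UDef.adj i j).not

variable {S : ∀ D : MarkedGraph.{u} Tag, D.V → D.V → Prop} (hS : BinDef k S)
include hS

theorem binDef_prec {d : ℕ} (hd : d + 1 < k) : BinDef k fun D => D.Prec (S D) d := fun i j =>
  have h := fun l => UDef.mark l (NeZero.pos k) Tag.zero
  (hS i j).and ((binDef_samePos hd i j).not.and
    (((h i).and ((h j).not.and (UDef.adj i j))).or
      ((h i).not.and ((h j).and (UDef.adj i j).not))))

theorem binDef_before {d : ℕ} (hd : d + 1 < k) : BinDef k fun D => D.Before (S D) d := fun i j =>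
  have h := @binDef_prec _ _ _ hS _ hd
  (h i j).or ((UDef.ex ((h (some i) none).and (h none (some j)))).or
    (UDef.ex (UDef.ex ((h (some (some i)) (some none)).and
      ((h (some none) none).and (h none (some (some j))))))))

theorem uDef_linked {R : ∀ D : MarkedGraph.{u} Tag, D.V → D.V → Prop} (hR : BinDef k R) (n : ℕ)
    {α : Type} (c i j : α) :
    UDef (k := k) fun D v => Linked (R D) (S D (v c).1) n (v i).1 (v j).1 := by
  induction n generalizing α with
  | zero => exact UDef.eq i j
  | succ n ih =>
    exact (UDef.eq i j).or (UDef.ex ((hS (some c) none).and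
      ((hR (some i) none).and (ih (some c) none (some j)))))

end Definability

theorem binDef_sameNode {k : ℕ} [NeZero k] {d : ℕ} (hd : d < k) :
    BinDef.{u} k fun D => D.SameNode d := by
  induction d with
  | zero => exact fun _ _ => UDef.true
  | succ d ih =>
    have hd' : d < k := by omega
    have hS : BinDef.{u} k fun D => D.SameNode d := ih hd'
    have hb : BinDef.{u} k fun D => D.Before (D.SameNode d) d := binDef_before hS hd
    intro α i j
    exact (hS i j).and
      (((UDef.mark i hd' _).and (uDef_linked hS (fun i j => UDef.adj i j) 5 i i j)).or
        (((UDef.mark i hd' _).and (uDef_linked hS binDef_coAdj 5 i i j)).or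
          ((UDef.mark i hd' _).and ((binDef_samePos hd i j).and
            ((hb i j).not.and (hb j i).not)))))

/-- The definition of the unary predicates of a bicotree. -/
def nodeMark (t : Tag) {k : ℕ} (D : MarkedGraph.{u} Tag) (w : D.Copies k) : Prop :=
  ∃ d : Fin k, w.2 = d ∧ D.mark d t w.1

/-- The definition of the relations of a bicotree. -/
def nodeRel (k : ℕ) : ∀ {n : ℕ}, (tLang 2).Relations n → ∀ D : MarkedGraph.{u} Tag,
    (Fin n → D.Copies k) → Prop
  | _, TRel.le, D, w => ∃ p : {p : Fin k × Fin k // p.1 ≤ p.2},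
      (w 0).2 = p.1.1 ∧ (w 1).2 = p.1.2 ∧ D.SameNode p.1.1 (w 0).1 (w 1).1
  | _, TRel.lt, D, w => ∃ d : {d : Fin k // (d : ℕ) + 1 < k},
      (w 0).2 = ⟨d + 1, d.2⟩ ∧ (w 1).2 = ⟨d + 1, d.2⟩ ∧ D.SameNode d (w 0).1 (w 1).1 ∧
      D.mark d Tag.isO (w 0).1 ∧ ∃ a, ∃ b, D.SameNode (d + 1) (w 0).1 a ∧
        D.SameNode (d + 1) (w 1).1 b ∧ D.Before (D.SameNode d) d a b
  | _, TRel.leaf, D, w => nodeMark Tag.leaf D (w 0)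
  | _, TRel.unordered, D, w => nodeMark Tag.unordered D (w 0)
  | _, TRel.ordered, D, w => nodeMark Tag.ordered D (w 0)
  | _, TRel.gamma i, D, w => nodeMark (Tag.gamma i) D (w 0)
  | _, TRel.kappa i j, D, w => nodeMark (Tag.kappa i j) D (w 0)

theorem uDef_nodeMark {k : ℕ} {α : Type} (i : α) (t : Tag) :
    UDef.{u} (k := k) fun D v => nodeMark t D (v i) :=
  UDef.exists_finite fun d => (UDef.copy i d).and (UDef.mark i d.isLt t)

theorem uDef_nodeRel {k : ℕ} [NeZero k] {n : ℕ} (r : (tLang 2).Relations n) :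
    UDef.{u} (nodeRel k r) := by
  cases r with
  | le =>
    exact UDef.exists_finite fun p => (UDef.copy 0 _).and ((UDef.copy 1 _).and
      (binDef_sameNode p.1.1.isLt 0 1))
  | lt =>
    refine UDef.exists_finite fun d => (UDef.copy 0 _).and ((UDef.copy 1 _).and
      ((binDef_sameNode d.1.isLt 0 1).and ((UDef.mark 0 d.1.isLt _).and
        (UDef.ex (UDef.ex ((binDef_sameNode d.2 (some (some 0)) (some none)).and
          ((binDef_sameNode d.2 (some (some 1)) none).and
            (binDef_before (binDef_sameNode d.1.isLt) d.2 (some none) none))))))))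
  | leaf => exact uDef_nodeMark 0 _
  | unordered => exact uDef_nodeMark 0 _
  | ordered => exact uDef_nodeMark 0 _
  | gamma i => exact uDef_nodeMark 0 _
  | kappa i j => exact uDef_nodeMark 0 _


/-! ### Encoding a clean bicotree by marks on its leaves -/

section

variable {M : Type u} [(tLang 2).Structure M] {V : Type u}

/-- The property of the node `u` encoded by a mark on the leaf `v`, where `rep` is a choice of a
leaf above each node. -/
def NodeProp (lf : V → M) (rep : M → V) (u : M) (v : V) : Tag → Prop
  | Tag.rep => rep u = v
  | Tag.isU => IsU u
  | Tag.isB => IsB u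
  | Tag.isO => IsO u
  | Tag.pos j => pos 2 u % 3 = j
  | Tag.zero => Zero (lf v)
  | Tag.leaf => Leaf 2 u
  | Tag.unordered => Unordered 2 u
  | Tag.ordered => Ordered 2 u
  | Tag.gamma i => Gamma i u
  | Tag.kappa i j => Kappa i j u

/-- The graph `G` with marks that encode a bicotree, whose leaves are given by `lf`. -/
abbrev encode (G : SimpleGraph V) (lf : V → M) (rep : M → V) : MarkedGraph.{u} Tag where
  V := V
  G := G
  mark := fun d t v => ∃ u : M, level 2 u = d ∧ Le 2 u (lf v) ∧ NodeProp lf rep u v t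

/-- The vertices of `G` are the leaves of `M`, through `lf`, and `M` models `G`. -/
structure IsLabeling (G : SimpleGraph V) (lf : V → M) : Prop where
  leaf : ∀ v, Leaf 2 (lf v)
  injective : Function.Injective lf
  surjective : ∀ x, Leaf 2 x → ∃ v, lf v = x
  adj : ∀ v w, G.Adj v w ↔ BAdj (lf v) (lf w)

/-- Identifies bounded walks that stay inside `X` with bounded walks in the subgraph on the leaves
of one subtree, for which cleanness is stated. -/
theorem Linked.map_iff {W : Type*} {V : Type*} {R : V → V → Prop} {R' : W → W → Prop}
    {X : V → Prop} {f : W → V} (hf : Function.Injective f) (hX : ∀ v, X v ↔ v ∈ Set.range f)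
    (hR : ∀ a b, R (f a) (f b) ↔ R' a b) (n : ℕ) (a b : W) :
    Linked R X n (f a) (f b) ↔ Linked R' (fun _ => True) n a b := by
  induction n generalizing a with
  | zero => exact hf.eq_iff
  | succ n ih =>
    refine or_congr hf.eq_iff ⟨?_, ?_⟩
    · rintro ⟨z, hz, hr, h⟩
      obtain ⟨c, rfl⟩ := (hX z).1 hz
      exact ⟨c, trivial, (hR _ _).1 hr, (ih c).1 h⟩
    · rintro ⟨c, -, hr, h⟩
      exact ⟨f c, (hX _).2 ⟨c, rfl⟩, (hR _ _).2 hr, (ih c).2 h⟩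

theorem IsBicotree.subtreeGraph_adj (hM : IsBicotree M) {u : M}
    {x y : {x : M // Leaf 2 x ∧ Le 2 u x}} : (subtreeGraph u).Adj x y ↔ BAdj x.1 y.1 := by
  rw [subtreeGraph, SimpleGraph.fromRel_adj, build_adj_realize, build_adj_realize]
  constructor
  · rintro ⟨-, h | h⟩
    · exact h
    · exact h.symm
  · exact fun h => ⟨fun e => hM.bAdj_ne x.2.1 y.2.1 h (congrArg Subtype.val e), Or.inl h⟩

theorem IsBicotree.subtreeBipCompl_adj (hM : IsBicotree M) {u : M}
    {x y : {x : M // Leaf 2 x ∧ Le 2 u x}} : (subtreeBipCompl u).Adj x y ↔ CoAdj x.1 y.1 := by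
  have hx := hM.gamma_one_iff x.2.1
  have hy := hM.gamma_one_iff y.2.1
  rw [subtreeBipCompl, SimpleGraph.fromRel_adj, hM.subtreeGraph_adj, hM.subtreeGraph_adj, hx, hy]
  change x ≠ y ∧ ((Zero x.1 ∧ ¬ Zero y.1) ∧ ¬ BAdj x.1 y.1 ∨
    (Zero y.1 ∧ ¬ Zero x.1) ∧ ¬ BAdj y.1 x.1) ↔ (Zero x.1 ↔ ¬ Zero y.1) ∧ ¬ BAdj x.1 y.1
  have hs : BAdj y.1 x.1 ↔ BAdj x.1 y.1 := ⟨BAdj.symm, BAdj.symm⟩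
  rw [hs]
  constructor
  · tauto
  · rintro ⟨h, h'⟩
    refine ⟨?_, by tauto⟩
    rintro rfl
    tauto

variable {G : SimpleGraph V} {lf : V → M} (rep : M → V)

theorem encode_mark_iff  (hM : IsTModel 2 M) {u : M} {v : V} (hu : Le 2 u (lf v)) (t : Tag) :
    (encode G lf rep).mark (level 2 u) t v ↔ NodeProp lf rep u v t := by
  constructor
  · rintro ⟨w, hw, hwv, h⟩
    obtain rfl := hM.eq_of_level_eq hwv hu hw
    exact h
  · exact fun h => ⟨u, rfl, hu, h⟩

/-- The tag `zero` concerns the leaf and not the ancestor, so it can be read at level 0, where every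
leaf has the root as ancestor. -/
theorem encode_zero_iff (hM : IsTModel 2 M) {v : V} :
    (encode G lf rep).mark 0 Tag.zero v ↔ Zero (lf v) := by
  obtain ⟨u, h0, hu⟩ := hM.exists_level_eq_zero (lf v)
  rw [← h0]
  exact encode_mark_iff rep hM hu Tag.zero

theorem encode_samePos_iff (hM : IsTModel 2 M) {c c' : M} {v w : V} (hc : Le 2 c (lf v))
    (hc' : Le 2 c' (lf w)) (h : level 2 c' = level 2 c) :
    (encode G lf rep).SamePos (level 2 c) v w ↔ pos 2 c % 3 = pos 2 c' % 3 := by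
  have h1 := fun j => encode_mark_iff (G := G) rep hM hc (Tag.pos j)
  have h2 := fun j => encode_mark_iff (G := G) rep hM hc' (Tag.pos j)
  rw [h] at h2
  refine (exists_congr fun j => and_congr (h1 j) (h2 j)).trans ⟨?_, ?_⟩
  · rintro ⟨j, h, h'⟩
    exact h.trans h'.symm
  · exact fun h => ⟨⟨pos 2 c % 3, Nat.mod_lt _ (by norm_num)⟩, rfl, h.symm⟩

variable (hlf : IsLabeling G lf)
include hlf

/-- Connectivity of the subtree of `u` in at most five steps. -/
theorem IsLabeling.linked_iff {u : M} {R : V → V → Prop}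
    {H : SimpleGraph {x : M // Leaf 2 x ∧ Le 2 u x}}
    (hR : ∀ (v w : V) (hv : Le 2 u (lf v)) (hw : Le 2 u (lf w)),
      R v w ↔ H.Adj ⟨lf v, hlf.leaf v, hv⟩ ⟨lf w, hlf.leaf w, hw⟩)
    (hP : ∀ p, ¬ IsSevenPath H.Adj p) {X : V → Prop} (hX : ∀ v, X v ↔ Le 2 u (lf v))
    {v w : V} (hv : Le 2 u (lf v)) (hw : Le 2 u (lf w)) :
    Linked R X 5 v w ↔ H.Reachable ⟨lf v, hlf.leaf v, hv⟩ ⟨lf w, hlf.leaf w, hw⟩ := by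
  -- `f` inverts `lf` on the leaves of the subtree of `u`.
  choose f hf using fun x : {x : M // Leaf 2 x ∧ Le 2 u x} => hlf.surjective x.1 x.2.1
  have hfl : ∀ (v : V) (hv : Le 2 u (lf v)), f ⟨lf v, hlf.leaf v, hv⟩ = v :=
    fun v hv => hlf.injective (hf _)
  have hinj : Function.Injective f := fun x y h => Subtype.ext (by rw [← hf x, ← hf y, h])
  have hle : ∀ x, Le 2 u (lf (f x)) := fun x => by rw [hf]; exact x.2.2
  rw [← linked_iff_reachable_of_noSevenPath hP, ← Linked.map_iff (R := R) (X := X) hinj,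
    hfl v hv, hfl w hw]
  · intro v
    rw [hX]
    constructor
    · exact fun h => ⟨_, hfl v h⟩
    · rintro ⟨x, rfl⟩
      exact hle x
  · intro x y
    rw [hR _ _ (hle x) (hle y)]
    simp only [hf]

theorem encode_coAdj_iff (hM : IsTModel 2 M) {v w : V} :
    (encode G lf rep).CoAdj v w ↔ CoAdj (lf v) (lf w) := by
  rw [MarkedGraph.CoAdj, encode_zero_iff rep hM, encode_zero_iff rep hM]
  change _ ∧ ¬ G.Adj v w ↔ _
  rw [hlf.adj, CoAdj]
  tauto

/-! ### Recovering the left-to-right order below an O-node. -/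

section Ordered

variable (hM : IsCleanBicotree M) {u : M} (hu : IsO u) {S : V → V → Prop}
  (hS : ∀ v w, Le 2 u (lf v) → (S v w ↔ Le 2 u (lf w)))
include hM hu hS

/-- Different residues force `c ≠ c'`. Then a leaf of the first color is adjacent to one of the
second exactly when it is on its left, so adjacency, or non-adjacency when the colors are exchanged,
says that `v` is on the left of `w`. -/
theorem encode_prec_iff {c c' : M} {v w : V} (hc : Child 2 u c) (hv : Le 2 c (lf v))
    (hc' : Child 2 u c') (hw : Le 2 c' (lf w)) :
    (encode G lf rep).Prec S (level 2 u) v w ↔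
      pos 2 c % 3 ≠ pos 2 c' % 3 ∧ (Zero (lf v) ↔ ¬ Zero (lf w)) ∧ pos 2 c < pos 2 c' := by
  have huv := hM.le_trans _ _ _ hc.1 hv
  have huw := hM.le_trans _ _ _ hc'.1 hw
  have hT := hM.toIsTModel
  have hl := hM.level_child hc
  have hl' := hM.level_child hc'
  have hp := encode_samePos_iff (G := G) rep hT hv hw (by rw [hl, hl'])
  rw [hl] at hp
  rw [MarkedGraph.Prec, hp, hS v w huv, encode_zero_iff rep hT, encode_zero_iff rep hT]
  change _ ∧ _ ∧ (_ ∧ _ ∧ G.Adj v w ∨ _ ∧ _ ∧ ¬ G.Adj v w) ↔ _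
  rw [hlf.adj]
  by_cases hne : pos 2 c % 3 = pos 2 c' % 3
  · simp [hne]
  have hcc : c ≠ c' := fun e => hne (by rw [e])
  have hpp : pos 2 c ≠ pos 2 c' := fun e => hne (by rw [e])
  by_cases zv : Zero (lf v) <;> by_cases zw : Zero (lf w)
  · simp [zv, zw]
  · have := hM.bAdj_iff_of_isO hu ⟨hlf.leaf v, hlf.leaf w, zv, zw, hc, hc', hv, hw⟩ hcc
    simp [zv, zw, this, huw]
  · have := hM.bAdj_iff_of_isO hu ⟨hlf.leaf w, hlf.leaf v, zw, zv, hc', hc, hw, hv⟩ hcc.symm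
    have hs : BAdj (lf v) (lf w) ↔ BAdj (lf w) (lf v) := ⟨BAdj.symm, BAdj.symm⟩
    simp only [zv, zw, hs, this, huw, hne, not_false_eq_true, not_true_eq_false, false_and,
      true_and, false_or, ne_eq]
    omega
  · simp [zv, zw]

theorem encode_before_pos {c c' : M} {v w : V} (hc : Child 2 u c) (hv : Le 2 c (lf v))
    (hc' : Child 2 u c') (hw : Le 2 c' (lf w))
    (h : (encode G lf rep).Before S (level 2 u) v w) : pos 2 c < pos 2 c' := by
  have key := @encode_prec_iff _ _ _ _ _ rep hlf hM _ hu _ hS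
  have hchild : ∀ {v w : V}, Le 2 u (lf v) → (encode G lf rep).Prec S (level 2 u) v w →
      ∃ d, Child 2 u d ∧ Le 2 d (lf w) := by
    intro v w h h'
    have huw := (hS v w h).1 h'.1
    exact hM.exists_child huw fun e => hM.not_leaf_of_child hc (e ▸ hlf.leaf w)
  have huv := hM.le_trans _ _ _ hc.1 hv
  rcases h with h | ⟨z, h1, h2⟩ | ⟨z, z', h1, h2, h3⟩
  · exact ((key hc hv hc' hw).1 h).2.2
  · obtain ⟨d, hd, hz⟩ := hchild huv h1
    exact ((key hc hv hd hz).1 h1).2.2.trans ((key hd hz hc' hw).1 h2).2.2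
  · obtain ⟨d, hd, hz⟩ := hchild huv h1
    obtain ⟨d', hd', hz'⟩ := hchild (hM.le_trans _ _ _ hd.1 hz) h2
    exact ((key hc hv hd hz).1 h1).2.2.trans (((key hd hz hd' hz').1 h2).2.2.trans
      ((key hd' hz' hc' hw).1 h3).2.2)

/-- Each step of `Prec` must change both the color and the residue. If the residues agree, then `pos
2 c' ≥ pos 2 c + 3`, which leaves room for intermediate children: two steps join leaves of equal
colors and three steps join leaves of different colors. Residues modulo 2 would not suffice, since
returning to the same residue would take an even number of steps and preserve the color. -/
theorem encode_before_of_pos {c c' : M} {v w : V} (hc : Child 2 u c) (hv : Le 2 c (lf v))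
    (hc' : Child 2 u c') (hw : Le 2 c' (lf w)) (h : pos 2 c < pos 2 c')
    (h' : pos 2 c % 3 = pos 2 c' % 3 ∨ (Zero (lf v) ↔ ¬ Zero (lf w))) :
    (encode G lf rep).Before S (level 2 u) v w := by
  have key := @encode_prec_iff _ _ _ _ _ rep hlf hM _ hu _ hS
  by_cases hne : pos 2 c % 3 = pos 2 c' % 3
  -- Cleanness at the O-node gives, under the child at any position below `pos 2 c'`, a leaf of the
  -- color prescribed by `P`.
  · have hleaf : ∀ (i : ℕ) (P : Prop), i < pos 2 c' →
        ∃ d z, Child 2 u d ∧ Le 2 d (lf z) ∧ pos 2 d = i ∧ (Zero (lf z) ↔ P) := by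
      intro i P hi
      obtain ⟨d, hd, rfl⟩ := hM.exists_pos_eq hu.1 hc' hi
      by_cases hP : P
      · obtain ⟨x, hx, hdx, hg⟩ := hM.clean_O u hu d hd 0
        obtain ⟨z, rfl⟩ := hlf.surjective x hx
        exact ⟨d, z, hd, hdx, rfl, iff_of_true hg hP⟩
      · obtain ⟨x, hx, hdx, hg⟩ := hM.clean_O u hu d hd 1
        obtain ⟨z, rfl⟩ := hlf.surjective x hx
        exact ⟨d, z, hd, hdx, rfl, iff_of_false ((hM.gamma_one_iff hx).1 hg) hP⟩
    obtain ⟨d, z, hd, hz, hpd, hzz⟩ := hleaf (pos 2 c + 1) (¬ Zero (lf v)) (by omega)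
    by_cases hcol : Zero (lf v) ↔ ¬ Zero (lf w)
    -- The chain runs through positions `pos 2 c`, `pos 2 c + 1`, `pos 2 c + 2`, `pos 2 c'`, and
    -- consecutive residues differ because the last one equals the first.
    · obtain ⟨d', z', hd', hz', hpd', hzz'⟩ := hleaf (pos 2 c + 2) (Zero (lf v)) (by omega)
      refine Or.inr (Or.inr ⟨z, z', (key hc hv hd hz).2 ⟨?_, ?_, ?_⟩,
        (key hd hz hd' hz').2 ⟨?_, ?_, ?_⟩, (key hd' hz' hc' hw).2 ⟨?_, ?_, ?_⟩⟩)
      all_goals first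
        | omega
        | tauto
    · refine Or.inr (Or.inl ⟨z, (key hc hv hd hz).2 ⟨?_, ?_, ?_⟩,
        (key hd hz hc' hw).2 ⟨?_, ?_, ?_⟩⟩)
      all_goals first
        | omega
        | tauto
  · exact Or.inl ((key hc hv hc' hw).2 ⟨hne, h'.resolve_left hne, h⟩)

end Ordered

/-- Once the common ancestor `u` at level `d` is known, its type selects the test for lying below
the same child: bounded connectivity at U-nodes and B-nodes, and equal residues with no chain in
either direction at O-nodes. -/
theorem encode_sameNode_iff (hM : IsCleanBicotree M) (d : ℕ) (v w : V) :
    (encode G lf rep).SameNode d v w ↔ ∃ u : M, level 2 u = d ∧ Le 2 u (lf v) ∧ Le 2 u (lf w) := by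
  have hT := hM.toIsTModel
  induction d generalizing v w with
  | zero =>
    obtain ⟨u, h0, hu⟩ := hM.exists_level_eq_zero (lf v)
    exact iff_of_true trivial ⟨u, h0, hu, hM.le_of_level_eq_zero h0 _⟩
  | succ d ih =>
    have hS : ∀ u : M, level 2 u = d → ∀ v w, Le 2 u (lf v) →
        ((encode G lf rep).SameNode d v w ↔ Le 2 u (lf w)) := by
      intro u hu v w huv
      refine (ih v w).trans ⟨?_, fun h => ⟨u, hu, huv, h⟩⟩
      rintro ⟨u', hu', huv', huw'⟩
      rwa [hM.eq_of_level_eq huv huv' (hu.trans hu'.symm)]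
    have hU : ∀ u : M, level 2 u = d → IsU u → Le 2 u (lf v) → Le 2 u (lf w) →
        (Linked G.Adj ((encode G lf rep).SameNode d v) 5 v w ↔
          ∃ c, Child 2 u c ∧ Le 2 c (lf v) ∧ Le 2 c (lf w)) := by
      intro u hu hU huv huw
      rw [← hM.clean_U u hU ⟨lf v, hlf.leaf v, huv⟩ ⟨lf w, hlf.leaf w, huw⟩]
      refine hlf.linked_iff (fun v w hv hw => ?_) (fun p hp => ?_) (fun z => hS u hu v z huv) huv huw
      · rw [hM.subtreeGraph_adj, hlf.adj]
      · simp only [funext fun x => funext fun y => propext (hM.subtreeGraph_adj (x := x) (y := y))]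
          at hp
        exact hM.not_isSevenPath_bAdj _ (fun i => (p i).2.1) hp.comap
    have hB : ∀ u : M, level 2 u = d → IsB u → Le 2 u (lf v) → Le 2 u (lf w) →
        (Linked (encode G lf rep).CoAdj ((encode G lf rep).SameNode d v) 5 v w ↔
          ∃ c, Child 2 u c ∧ Le 2 c (lf v) ∧ Le 2 c (lf w)) := by
      intro u hu hB huv huw
      rw [← hM.clean_B u hB ⟨lf v, hlf.leaf v, huv⟩ ⟨lf w, hlf.leaf w, huw⟩]
      refine hlf.linked_iff (fun v w hv hw => ?_) (fun p hp => ?_) (fun z => hS u hu v z huv) huv huw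
      · rw [hM.subtreeBipCompl_adj, encode_coAdj_iff rep hlf hT]
      · simp only [funext fun x => funext fun y =>
          propext (hM.subtreeBipCompl_adj (x := x) (y := y))] at hp
        exact hM.not_isSevenPath_coAdj _ (fun i => (p i).2.1) hp.comap
    have hO : ∀ u : M, level 2 u = d → IsO u → Le 2 u (lf v) → Le 2 u (lf w) →
        ((encode G lf rep).SamePos (d + 1) v w ∧
          ¬ (encode G lf rep).Before ((encode G lf rep).SameNode d) d v w ∧
          ¬ (encode G lf rep).Before ((encode G lf rep).SameNode d) d w v ↔
          ∃ c, Child 2 u c ∧ Le 2 c (lf v) ∧ Le 2 c (lf w)) := by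
      rintro u hu hO huv huw
      have hul : ¬ Leaf 2 u := (hM.internal u).2 (Or.inr hO.1)
      have hSu := hS u hu
      subst hu
      obtain ⟨c, hc, hcv⟩ := hM.exists_child huv fun e => hul (e ▸ hlf.leaf v)
      obtain ⟨c', hc', hcw⟩ := hM.exists_child huw fun e => hul (e ▸ hlf.leaf w)
      have hl := hM.level_child hc
      have hl' := hM.level_child hc'
      rw [← hl, encode_samePos_iff rep hT hcv hcw (by rw [hl, hl'])]
      constructor
      · rintro ⟨hp, h1, h2⟩
        -- With equal residues, distinct positions would yield a chain whatever the colors of `v`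
        -- and `w`.
        have e : pos 2 c = pos 2 c' := by
          by_contra hne
          rcases lt_or_gt_of_ne hne with h | h
          · exact h1 (encode_before_of_pos rep hlf hM hO hSu hc hcv hc' hcw h (Or.inl hp))
          · exact h2 (encode_before_of_pos rep hlf hM hO hSu hc' hcw hc hcv h (Or.inl hp.symm))
        obtain rfl := hM.eq_of_pos_eq hO.1 hc hc' e
        exact ⟨c, hc, hcv, hcw⟩
      · rintro ⟨b, hb, hbv, hbw⟩
        obtain rfl := hM.child_unique hb hc hbv hcv
        obtain rfl := hM.child_unique hb hc' hbw hcw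
        exact ⟨rfl, fun h => lt_irrefl _ (encode_before_pos rep hlf hM hO hSu hc hcv hc' hcw h),
          fun h => lt_irrefl _ (encode_before_pos rep hlf hM hO hSu hc hcw hc' hcv h)⟩
    constructor
    · rintro ⟨hs, ht⟩
      obtain ⟨u, hu, huv, huw⟩ := (ih v w).1 hs
      have hm := fun t => encode_mark_iff (G := G) rep hT huv t
      rw [hu] at hm
      have : ∃ c, Child 2 u c ∧ Le 2 c (lf v) ∧ Le 2 c (lf w) := by
        rcases ht with ⟨ht, h⟩ | ⟨ht, h⟩ | ⟨ht, h⟩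
        · exact (hU u hu ((hm _).1 ht) huv huw).1 h
        · exact (hB u hu ((hm _).1 ht) huv huw).1 h
        · exact (hO u hu ((hm _).1 ht) huv huw).1 h
      obtain ⟨c, hc, hcv, hcw⟩ := this
      exact ⟨c, by rw [hM.level_child hc, hu], hcv, hcw⟩
    · rintro ⟨c, hcl, hcv, hcw⟩
      obtain ⟨u, hc, hu⟩ := hM.exists_parent hcl
      have huv := hM.le_trans _ _ _ hc.1 hcv
      have huw := hM.le_trans _ _ _ hc.1 hcw
      have hm := fun t => encode_mark_iff (G := G) rep hT huv t
      rw [hu] at hm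
      refine ⟨(ih v w).2 ⟨u, hu, huv, huw⟩, ?_⟩
      rcases hM.types u (hM.not_leaf_of_child hc) with h | h | h
      · exact Or.inl ⟨(hm _).2 h, (hU u hu h huv huw).2 ⟨c, hc, hcv, hcw⟩⟩
      · exact Or.inr (Or.inl ⟨(hm _).2 h, (hB u hu h huv huw).2 ⟨c, hc, hcv, hcw⟩⟩)
      · exact Or.inr (Or.inr ⟨(hm _).2 h, (hO u hu h huv huw).2 ⟨c, hc, hcv, hcw⟩⟩)

end


/-! ### Clean bicotrees are outputs of a transduction -/

section

variable {M : Type u} [(tLang 2).Structure M] {V : Type u}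

theorem isLabeling_of_models {G : SimpleGraph V}
    (ι : (build 2).Carrier M ≃ V) (h : (build 2).Models M G ι) :
    IsLabeling G fun v => (ι.symm v).1 where
  leaf v := (build_dom_realize 2 _).1 (ι.symm v).2
  injective v w e := ι.symm.injective (Subtype.ext e)
  surjective x hx := ⟨ι ⟨x, (build_dom_realize 2 x).2 hx⟩,
    congrArg Subtype.val (ι.symm_apply_apply _)⟩
  adj v w := by
    have := h (ι.symm v) (ι.symm w)
    rw [ι.apply_symm_apply, ι.apply_symm_apply] at this
    rw [← this, BAdj, ← build_adj_realize]
    change ((build 2).rel adj).Realize (fun i => (![ι.symm v, ι.symm w] i).1) ↔ _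
    rw [show (fun i => (![ι.symm v, ι.symm w] i).1) = ![(ι.symm v).1, (ι.symm w).1] from
      funext fun i => by fin_cases i <;> rfl]

variable {G : SimpleGraph V} {lf : V → M} {rep : M → V} {k : ℕ}

theorem nodeMark_encode_iff (hM : IsTModel 2 M) {u : M} {v : V} (hu : Le 2 u (lf v))
    (hk : level 2 u < k) (t : Tag) :
    nodeMark t (encode G lf rep) (v, (⟨level 2 u, hk⟩ : Fin k)) ↔ NodeProp lf rep u v t := by
  rw [← encode_mark_iff (G := G) rep hM hu t]
  constructor
  · rintro ⟨d, hd, h⟩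
    obtain rfl : _ = d := hd
    exact h
  · exact fun h => ⟨_, rfl, h⟩

variable (hlf : IsLabeling G lf) (hM : IsCleanBicotree M) (hrep : ∀ u, Le 2 u (lf (rep u)))
  (hk : ∀ u : M, level 2 u < k)
include hlf hM hrep hk

/-- `SameNode` at the level of `u` says that `u` is an ancestor of `rep v`. Then `u` and `v` are
comparable, and their levels decide which is the smaller one. -/
theorem nodeRel_le_encode_iff (u v : M) : Le 2 u v ↔
    nodeRel k (leSym 2) (encode G lf rep)
      ![(rep u, (⟨level 2 u, hk u⟩ : Fin k)), (rep v, (⟨level 2 v, hk v⟩ : Fin k))] := by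
  constructor
  · intro h
    refine ⟨⟨(⟨level 2 u, hk u⟩, ⟨level 2 v, hk v⟩), hM.level_le h⟩, rfl, rfl, ?_⟩
    exact (encode_sameNode_iff rep hlf hM _ _ _).2
      ⟨u, rfl, hrep u, hM.le_trans _ _ _ h (hrep v)⟩
  · rintro ⟨⟨⟨d, d'⟩, hd⟩, h1, h2, h⟩
    obtain rfl : _ = d := h1
    obtain rfl : _ = d' := h2
    obtain ⟨w, hw, hwu, hwv⟩ := (encode_sameNode_iff rep hlf hM _ _ _).1 h
    obtain rfl := hM.eq_of_level_eq hwu (hrep u) hw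
    exact hM.le_of_level_le hwv (hrep v) hd

theorem nodeRel_lt_encode_iff (u v : M) : Lt 2 u v ↔
    nodeRel k (ltSym 2) (encode G lf rep)
      ![(rep u, (⟨level 2 u, hk u⟩ : Fin k)), (rep v, (⟨level 2 v, hk v⟩ : Fin k))] := by
  have hS : ∀ m : M, ∀ v w, Le 2 m (lf v) →
      ((encode G lf rep).SameNode (level 2 m) v w ↔ Le 2 m (lf w)) := by
    intro m v w hv
    refine (encode_sameNode_iff rep hlf hM _ v w).trans ⟨?_, fun h => ⟨m, rfl, hv, h⟩⟩
    rintro ⟨m', h, hv', hw'⟩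
    rwa [hM.eq_of_level_eq hv hv' h.symm]
  constructor
  · intro h
    obtain ⟨m, hm, hu, hv⟩ := hM.parent_of_lt h
    have hO : IsO m := by
      rcases hM.types m (hM.not_leaf_of_child hu) with h' | h' | h'
      · exact absurd hm (hM.unordered_not_ordered m h'.1)
      · exact absurd hm (hM.unordered_not_ordered m h'.1)
      · exact h'
    have hlu := hM.level_child hu
    have hlv := hM.level_child hv
    have hmu := hM.le_trans _ _ _ hu.1 (hrep u)
    have hmv := hM.le_trans _ _ _ hv.1 (hrep v)
    refine ⟨⟨⟨level 2 m, hk m⟩, hlu ▸ hk u⟩, Fin.ext hlu, Fin.ext hlv, (hS m _ _ hmu).2 hmv,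
      (encode_mark_iff rep hM.toIsTModel hmu Tag.isO).2 hO, ?_⟩
    -- The representatives of `u` and `v` may have the same color. Leaves of different colors are
    -- taken instead, so that a chain exists whatever the residues of the positions.
    obtain ⟨x, hx, hux, hgx⟩ := hM.clean_O m hO u hu 0
    obtain ⟨y, hy, hvy, hgy⟩ := hM.clean_O m hO v hv 1
    obtain ⟨a, rfl⟩ := hlf.surjective x hx
    obtain ⟨b, rfl⟩ := hlf.surjective y hy
    have hSu := (hS u (rep u) a (hrep u)).2 hux
    have hSv := (hS v (rep v) b (hrep v)).2 hvy
    rw [hlu] at hSu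
    rw [hlv] at hSv
    exact ⟨a, b, hSu, hSv, encode_before_of_pos rep hlf hM hO (hS m) hu hux hv hvy (hM.pos_lt h)
      (Or.inr (iff_of_true hgx ((hM.gamma_one_iff hy).1 hgy)))⟩
  · rintro ⟨⟨⟨d, hdk⟩, hd⟩, h1, h2, hs, hm, a, b, ha, hb, hab⟩
    have hlu : level 2 u = d + 1 := congrArg Fin.val h1
    have hlv : level 2 v = d + 1 := congrArg Fin.val h2
    obtain ⟨m, hml, hmu, hmv⟩ := (encode_sameNode_iff rep hlf hM _ _ _).1 hs
    obtain ⟨p, hp, hpl⟩ := hM.exists_parent hlu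
    obtain ⟨q, hq, hql⟩ := hM.exists_parent hlv
    obtain rfl := hM.eq_of_level_eq (hM.le_trans _ _ _ hp.1 (hrep u)) hmu (hpl.trans hml.symm)
    obtain rfl := hM.eq_of_level_eq (hM.le_trans _ _ _ hq.1 (hrep v)) hmv (hql.trans hml.symm)
    obtain rfl : level 2 q = d := hml
    have hO : IsO q := (encode_mark_iff rep hM.toIsTModel hmu Tag.isO).1 hm
    rw [← hlu] at ha
    rw [← hlv] at hb
    exact (hM.lt_iff_pos_lt hO.1 hp hq).2 (encode_before_pos rep hlf hM hO (hS q) hp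
      ((hS u _ _ (hrep u)).1 ha) hq ((hS v _ _ (hrep v)).1 hb) hab)

theorem nodeRel_encode_iff {n : ℕ} (r : (tLang 2).Relations n) (xs : Fin n → M) :
    RelMap r xs ↔ nodeRel k r (encode G lf rep)
      ((fun u => (rep u, (⟨level 2 u, hk u⟩ : Fin k))) ∘ xs) := by
  have h1 : ∀ ys : Fin 1 → M, ys = ![ys 0] := fun ys => funext fun i => by fin_cases i; rfl
  have h2 : ∀ ys : Fin 2 → M, ys = ![ys 0, ys 1] := fun ys => funext fun i => by
    fin_cases i <;> rfl
  have hT := hM.toIsTModel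
  cases r with
  | le =>
    rw [h2 xs]
    exact nodeRel_le_encode_iff hlf hM hrep hk _ _
  | lt =>
    rw [h2 xs]
    exact nodeRel_lt_encode_iff hlf hM hrep hk _ _
  | leaf => rw [h1 xs]; exact (nodeMark_encode_iff hT (hrep _) (hk _) Tag.leaf).symm
  | unordered => rw [h1 xs]; exact (nodeMark_encode_iff hT (hrep _) (hk _) Tag.unordered).symm
  | ordered => rw [h1 xs]; exact (nodeMark_encode_iff hT (hrep _) (hk _) Tag.ordered).symm
  | gamma i => rw [h1 xs]; exact (nodeMark_encode_iff hT (hrep _) (hk _) (Tag.gamma i)).symm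
  | kappa i j => rw [h1 xs]; exact (nodeMark_encode_iff hT (hrep _) (hk _) (Tag.kappa i j)).symm

end

/-- A single transduction yields all clean bicotree models of bounded height. -/
theorem exists_transduction_isAccessible (h : ℕ) :
    ∃ T : Transduction FirstOrder.Language.graph (tLang 2),
      ∀ (V : Type u) (G : SimpleGraph V) (M : Type u) [(tLang 2).Structure M]
        (ι : (build 2).Carrier M ≃ V), IsCleanBicotree M → HeightLE 2 M h →
        (build 2).Models M G ι → IsAccessible (build 2) T M G ι := by
  -- Levels are smaller than `h`, so `h` copies would hold all nodes; the extra copy keeps `k`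
  -- nonzero when `h = 0`. The domain consists of the clones `(v, d)` such that `v` represents its
  -- ancestor at level `d`.
  obtain ⟨T, hT⟩ := exists_transduction.{u} (Tag := Tag) (k := h + 1) (L := tLang 2)
    (uDef_nodeMark (0 : Fin 1) Tag.rep) (fun r => uDef_nodeRel r)
  refine ⟨T, fun V G M _ ι hM hh hG => ?_⟩
  have hlf := isLabeling_of_models ι hG
  have hrep : ∀ u : M, ∃ v, Le 2 u (ι.symm v).1 := fun u => by
    obtain ⟨x, hx, hux⟩ := hM.exists_leaf u
    obtain ⟨v, rfl⟩ := hlf.surjective x hx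
    exact ⟨v, hux⟩
  choose rep hrep using hrep
  have hk : ∀ u : M, level 2 u < h + 1 := fun u => (hM.level_lt_of_height hh u).trans
    (Nat.lt_succ_self h)
  refine ⟨rep, hT (encode G (fun v => (ι.symm v).1) rep) M (fun u => (rep u, ⟨level 2 u, hk u⟩))
    ?_ ?_ (fun r xs => nodeRel_encode_iff hlf hM hrep hk r xs), fun x => ?_⟩
  · intro u v e
    have e1 : rep u = rep v := congrArg Prod.fst e
    have e2 : level 2 u = level 2 v := congrArg (fun p => (Prod.snd p : Fin (h + 1)).val) e
    exact hM.eq_of_level_eq (hrep u) (e1 ▸ hrep v) e2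
  · rintro ⟨v, d⟩
    constructor
    · rintro ⟨d', hd, u, hu, -, hv⟩
      obtain rfl : d = d' := hd
      exact ⟨u, Prod.ext hv (Fin.ext hu)⟩
    · rintro ⟨u, hu⟩
      rw [← hu]
      exact (nodeMark_encode_iff (lf := fun v => (ι.symm v).1) hM.toIsTModel (hrep u) (hk u) Tag.rep).2 rfl
  -- Nothing lies strictly above a leaf, so a leaf represents itself and is a clone of its own
  -- vertex.
  · have := (hM.leaf_iff x.1).1 ((build_dom_realize 2 _).1 x.2) _ (hrep x.1)
    have e : ι.symm (rep x.1) = x := Subtype.ext this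
    exact (ι.symm_apply_eq.1 e)

/-! ### Restriction of T-models -/

section Restriction

variable {L : FirstOrder.Language.{0, 0}} {M : Type u} [L.Structure M] {S : L.Substructure M}

theorem relMap_coe_one (r : L.Relations 1) (x : S) : RelMap r ![x] ↔ RelMap r ![(x : M)] := by
  change RelMap r (fun i => ((![x] i : S) : M)) ↔ _
  rw [show (fun i => ((![x] i : S) : M)) = ![(x : M)] from funext fun i => by fin_cases i; rfl]

theorem relMap_coe_two (r : L.Relations 2) (x y : S) :
    RelMap r ![x, y] ↔ RelMap r ![(x : M), (y : M)] := by
  change RelMap r (fun i => ((![x, y] i : S) : M)) ↔ _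
  rw [show (fun i => ((![x, y] i : S) : M)) = ![(x : M), (y : M)] from
    funext fun i => by fin_cases i <;> rfl]

end Restriction

/-- Everything that `λ` quantifies over, namely the infimum, the lower bounds tested against it and
the ancestors compared by `◁`, lies below `x` or `y`, hence in the downset. -/
theorem Lambda_restrictTo_iff {n : ℕ} {M : Type u} [(tLang n).Structure M] (hM : IsTModel n M)
    {X : Set M} (x y : restrictTo n M X) : Lambda n x y ↔ Lambda n (x : M) y := by
  have hle : ∀ a b : restrictTo n M X, Le n a b ↔ Le n (a : M) b := relMap_coe_two _
  have hlt : ∀ a b : restrictTo n M X, Lt n a b ↔ Lt n (a : M) b := relMap_coe_two _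
  have hun : ∀ a : restrictTo n M X, Unordered n a ↔ Unordered n (a : M) := relMap_coe_one _
  have hor : ∀ a : restrictTo n M X, Ordered n a ↔ Ordered n (a : M) := relMap_coe_one _
  have hga : ∀ (i : Fin n) (a : restrictTo n M X), Gamma i a ↔ Gamma i (a : M) :=
    fun i => relMap_coe_one _
  have hka : ∀ (i j : Fin n) (a : restrictTo n M X), Kappa i j a ↔ Kappa i j (a : M) :=
    fun i j => relMap_coe_one _
  have hdown : ∀ (a : M) (b : restrictTo n M X), Le n a b → a ∈ restrictTo n M X := by
    rintro a ⟨b, c, hc, hbc⟩ hab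
    exact ⟨c, hc, hM.le_trans _ _ _ hab hbc⟩
  simp only [Lambda, hle, hlt, hun, hor, hga, hka, ne_eq, Subtype.ext_iff]
  constructor
  · rintro ⟨m, ⟨hx, hy, hm⟩, ht, hk⟩
    refine ⟨m, ⟨hx, hy, fun z hzx hzy => hm ⟨z, hdown z x hzx⟩ hzx hzy⟩, ht.imp id ?_, hk⟩
    rintro ⟨ho, a, b, h⟩
    exact ⟨ho, a, b, h⟩
  · rintro ⟨m, ⟨hx, hy, hm⟩, ht, hk⟩
    refine ⟨⟨m, hdown m x hx⟩, ⟨hx, hy, fun z => hm z⟩, ht.imp id ?_, hk⟩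
    rintro ⟨ho, a, b, ha, hb, h⟩
    exact ⟨ho, ⟨a, hdown a x ha⟩, ⟨b, hdown b y hb⟩, ha, hb, h⟩

theorem isModelRestriction_restrictTo (n : ℕ) (C : GraphClass.{u}) :
    IsModelRestriction C (build n) (fun M _ => IsTModel n M) (fun M _ X => restrictTo n M X) := by
  intro V G _ M _ hM ι _ X hX
  refine ⟨fun x hx => ⟨x, hx, hM.le_refl x⟩, fun y => ?_, fun y z _ _ => ?_⟩
  · rw [build_dom_realize, Leaf, relMap_coe_one]
    constructor
    · intro h
      obtain ⟨x, hx, hyx⟩ := y.2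
      -- A leaf below some `x ∈ X` is equal to `x`, so the restriction contains no leaves outside
      -- `X`.
      rwa [← (hM.leaf_iff _).1 h x hyx]
    · exact fun h => (build_dom_realize n _).1 (hX _ h)
  · rw [build_adj_realize, build_adj_realize, Lambda_restrictTo_iff hM, Lambda_restrictTo_iff hM]

end TreeModel

theorem mainTheorem6 (h : ℕ) :
    ∃ Model : Transduction FirstOrder.Language.graph (tLang 2),
      ∀ C : GraphClass.{u},
        (∀ (V : Type u) (G : SimpleGraph V), C V G → IsSob G) →
        (∀ (V : Type u) (G : SimpleGraph V), C V G →
          ∃ (M : Type u) (_ : (tLang 2).Structure M) (ι : (build 2).Carrier M ≃ V),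
            IsCleanBicotree M ∧ HeightLE 2 M h ∧ (build 2).Models M G ι) →
        IsModelization (leafSym 2) C (build 2) Model ∧
        (∀ (V : Type u) (G : SimpleGraph V), C V G →
          ∀ (M : Type u) [(tLang 2).Structure M] (ι : (build 2).Carrier M ≃ V),
            IsCleanBicotree M → HeightLE 2 M h → (build 2).Models M G ι →
            IsAccessible (build 2) Model M G ι) ∧
        IsModelRestriction C (build 2) (fun M _ => IsTModel 2 M) (fun M _ X => restrictTo 2 M X) :=
 by
  obtain ⟨T, hT⟩ := exists_transduction_isAccessible.{u} h
  refine ⟨T, fun C _ hC => ⟨⟨fun M _ x => build_dom_realize 2 x, fun V G hG => ?_⟩,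
    fun V G _ M _ ι hM hh hG => hT V G M ι hM hh hG, isModelRestriction_restrictTo 2 C⟩⟩
  obtain ⟨M, _, ι, hM, hh, hm⟩ := hC V G hG
  exact ⟨M, inferInstance, ι, hm, hT V G M ι hM hh hm⟩
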